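/- Let $d\ge 2$ and let $T$ be the $(d+1)$-regular tree, with unit weights on its edges. Let $\widetilde T$ be its cable system (metric graph): each edge of $T$ is replaced by a compact segment of length $1/2$ joining its two endpoints. Let $\widetilde g(z,z')$, $z,z'\in\widetilde T$, be the Green function, with respect to the Lebesgue measure on $\widetilde T$, of the diffusion on $\widetilde T$ that behaves as a standard Brownian motion inside each segment and that leaves each vertex symmetrically through its $d+1$ adjacent segments; that is, $\widetilde g(z,\cdot)$ is the smallest nonnegative solution of $-\tfrac12 h''=\delta_z$ on $\widetilde T$ with Kirchhoff conditions at the vertices (at each vertex different from $z$ the outgoing derivatives of $h$ sum to $0$). Let $(\widetilde\varphi_z)_{z\in\widetilde T}$ be the Gaussian free field on $\widetilde T$, i.e. a centered Gaussian process with almost surely continuous sample paths and covariance $\widetilde g(\cdot,\cdot)$. Then, almost surely, all connected components of $\{z\in\widetilde T:\ \widetilde\varphi_z>0\}$ are bounded, i.e. each is contained in a ball of finite radius for the geodesic distance on $\widetilde T$. -/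

import Mathlib

open MeasureTheory ProbabilityTheory Set

noncomputable section

namespace CableGFF

variable {V : Type*}

/-- The cable system (metric graph) of a graph `G` without isolated vertices, as the geometric
realization of `G` in barycentric coordinates: a point is a convex combination of the two endpoints
`x`, `y` of an edge, and `p v` is its weight at the vertex `v`. It carries the topology of
coordinatewise convergence, which for a locally finite graph is the topology obtained by gluing
compact intervals, one for each edge, at the vertices. -/
abbrev CableSystem (G : SimpleGraph V) : Type _ :=
  {p : V → ℝ // (∀ v, 0 ≤ p v) ∧
    ∃ x y, G.Adj x y ∧ p x + p y = 1 ∧ ∀ v, v ≠ x → v ≠ y → p v = 0}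

open Classical in
/-- The point at fraction `t ∈ [0, 1]` of the way from `x` to `y` on the segment attached to the
edge `{x, y}` (values of `t` outside `[0, 1]` are clamped to the nearest endpoint). -/
def edgePt {G : SimpleGraph V} {x y : V} (hxy : G.Adj x y) (t : ℝ) : CableSystem G :=
  ⟨fun v => if v = x then 1 - max 0 (min 1 t) else if v = y then max 0 (min 1 t) else 0, by
    have h0 : 0 ≤ max 0 (min 1 t) := le_max_left _ _
    have h1 : max 0 (min 1 t) ≤ 1 := max_le zero_le_one (min_le_left _ _)
    refine ⟨fun v => ?_, x, y, hxy, ?_, fun v hx hy => ?_⟩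
    · dsimp only
      split_ifs <;> linarith
    · simp [hxy.ne']
    · simp [hx, hy]⟩

/-- Geodesic distance in the cable system from the vertex `x` to the point `p`, every segment being
given length `1`: go from `x` to an endpoint `y` of the segment containing `p` along edges, and then
along that segment. -/
def vertexDist (G : SimpleGraph V) (x : V) (p : CableSystem G) : ℝ :=
  ⨅ y : {y : V // p.1 y ≠ 0}, ((G.dist x y : ℝ) + (1 - p.1 y))

/-- A subset of the cable system is bounded if it is contained in some ball
`B_N(x) = {p | d(x, p) ≤ N}` around a vertex. -/
def IsBoundedSubset (G : SimpleGraph V) (C : Set (CableSystem G)) : Prop :=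
  ∃ (x : V) (N : ℕ), ∀ p ∈ C, vertexDist G x p ≤ N

/-- The length `(2 c)⁻¹` of the segment attached to an edge of weight `c = 1`; it normalizes the
Lebesgue measure on the cable system and the derivatives along segments. -/
def edgeLength : ℝ := (2 * 1)⁻¹

/-- The derivative of `h`, with respect to Lebesgue length, at the point at fraction `t ∈ [0, 1)` of
the edge from `x` to `y`, in the direction of `y`. -/
def outSlope {G : SimpleGraph V} (h : CableSystem G → ℝ) {x y : V} (hxy : G.Adj x y) (t : ℝ) : ℝ :=
  derivWithin (fun s => h (edgePt hxy s)) (Ioi t) t / edgeLength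

open Classical in
/-- `h` solves `-(1/2) h'' = δ_z` on the cable system of `G` with unit weights, that is, for the
generator `(1/2) d²/dℓ²` (with Kirchhoff conditions at the vertices) of the diffusion on the cable
system which is a standard Brownian motion inside the segments and which leaves a vertex along each of
the adjacent segments with equal weight. On segments `h` is affine away from `z` (which makes `h`
continuous); at every point, half the sum of the derivatives in all the directions leading out of this
point is `-1` if the point is `z`, and `0` otherwise. -/
structure IsFundamentalSolution (G : SimpleGraph V) [G.LocallyFinite] (z : CableSystem G)
    (h : CableSystem G → ℝ) : Prop where
  affine : ∀ ⦃x y : V⦄ (hxy : G.Adj x y) (a b : ℝ), 0 ≤ a → a ≤ b → b ≤ 1 →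
    (∀ t ∈ Ioo a b, edgePt hxy t ≠ z) →
    ∃ α β : ℝ, ∀ t ∈ Icc a b, h (edgePt hxy t) = α + β * t
  vertex : ∀ x : V, (1 / 2) * ∑ y : G.neighborSet x, outSlope h y.2 0 =
    if z.1 x = 1 then -1 else 0
  interior : ∀ ⦃x y : V⦄ (hxy : G.Adj x y), ∀ t ∈ Ioo (0 : ℝ) 1,
    (1 / 2) * (outSlope h hxy t + outSlope h hxy.symm (1 - t)) =
      if edgePt hxy t = z then -1 else 0

/-- The Green function, with respect to Lebesgue measure, of the diffusion on the cable system of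
`G` with unit weights: `green G z` is the smallest nonnegative solution of `-(1/2) h'' = δ_z`. -/
def green (G : SimpleGraph V) [G.LocallyFinite] (z w : CableSystem G) : ℝ :=
  sInf {r | ∃ h : CableSystem G → ℝ, IsFundamentalSolution G z h ∧ (∀ p, 0 ≤ h p) ∧ r = h w}

/-- `φ` is a Gaussian free field on the cable system of `G` with unit weights, under `P`: a centered
Gaussian process with a.s. continuous sample paths, whose covariance is the Green function. -/
structure IsGFF {Ω : Type*} [MeasurableSpace Ω] (G : SimpleGraph V) [G.LocallyFinite]
    (P : Measure Ω) (φ : CableSystem G → Ω → ℝ) : Prop where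
  gaussian : IsGaussianProcess φ P
  centered : ∀ z, ∫ ω, φ z ω ∂P = 0
  covariance : ∀ z w, ∫ ω, φ z ω * φ w ω ∂P = green G z w
  continuous : ∀ᵐ ω ∂P, Continuous fun z => φ z ω

end CableGFF

end

noncomputable section

namespace CableGFF

variable {V : Type*} {G : SimpleGraph V}

/-! ### Trees -/

/-! Say that a dart survives if the field is positive along arbitrarily long chains of segments
growing out of it. An unbounded positive cluster is connected, hence covers whole segments, and
produces a surviving dart (`exists_mem_survive`). Since there are countably many darts, it suffices
that each one survives with probability zero.

Let m be the expectation of the field at the starting vertex of a dart, restricted to survival; by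
homogeneity m does not depend on the dart. Let v be the far end of its segment. On the event that
some child survives, explore the segment from v back to the start. By the Markov property, paths
stopped on reaching zero contribute nothing to the expectation at the start, and regression from v
to the start costs a factor 1/d. Hence m ≤ E[φ_v; some child survives] / d
(`setIntegral_surviveSet_le`). The d children together give d·m = ∑ E[φ_v; child k survives], which
exceeds E[φ_v; some child survives] by at least E[φ_v; children i and j survive]. So this last
quantity is at most 0, although φ_v > 0 there: two children almost surely do not survive together
(`measure_surviveSet_inter`). Given φ_v, the children are independent with the same law, so the
square of their conditional survival probability vanishes (`measure_surviveSet_child`).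

The Gaussian input is reduced to covariances. The Green function is computed explicitly
(`green_edgePt`), its minimality coming from a minimum principle (`nonneg_of_harmonic`). Its
factorizations, collected in `BranchingField`, give the Markov property, the conditional
independence of siblings and the equality in law of all darts. Only points at rational fractions of
segments enter, and a grid with fourth moments replaces stopping times. -/

theorem dist_eq_add_one_of_ne (hT : G.IsTree) {u a b c : V} (hab : G.Adj a b) (hbc : G.Adj b c)
    (hac : a ≠ c) (h : G.dist u b = G.dist u a + 1) : G.dist u c = G.dist u b + 1 := by
  -- If `c` were closer to `u` than `b`, shortest paths to `a` and to `c` would both extend to paths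
  -- to `b`; uniqueness of paths would force `a = c`.
  rcases hT.dist_eq_dist_add_one_of_adj u hbc with h' | h'
  · exfalso
    obtain ⟨p, hp⟩ := hT.connected.exists_walk_length_eq_dist u a
    obtain ⟨q, hq⟩ := hT.connected.exists_walk_length_eq_dist u c
    have hp' : (p.concat hab).IsPath :=
      SimpleGraph.Walk.isPath_of_length_eq_dist _ (by rw [SimpleGraph.Walk.length_concat, hp, h])
    have hq' : (q.concat hbc.symm).IsPath :=
      SimpleGraph.Walk.isPath_of_length_eq_dist _ (by rw [SimpleGraph.Walk.length_concat, hq, h'])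
    have := (hT.existsUnique_path u b).unique hp' hq'
    have := congrArg SimpleGraph.Walk.penultimate this
    simp at this
    exact hac this
  · exact h'

/-- The last step of a shortest path. -/
theorem exists_adj_dist_add_one (hG : G.Connected) {o v : V} (h : o ≠ v) :
    ∃ w, G.Adj w v ∧ G.dist o w + 1 = G.dist o v := by
  obtain ⟨p, hp⟩ := hG.exists_walk_length_eq_dist o v
  have hadj := p.adj_penultimate fun hn => h hn.eq
  have h1 : G.dist o p.penultimate ≤ p.dropLast.length := SimpleGraph.dist_le _
  have h2 : 0 < G.dist o v := hG.pos_dist_of_ne h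
  have h3 : p.dropLast.length + 1 = G.dist o v := by simp [hp]; omega
  have h4 := hadj.diff_dist_adj (u := o)
  exact ⟨p.penultimate, hadj, by omega⟩

/-- An enumeration, for every dart `e`, of the darts that continue `e` without backtracking. -/
structure ChildEnum (G : SimpleGraph V) (d : ℕ) where
  /-- the `i`-th continuation of a dart -/
  child : G.Dart → Fin d → G.Dart
  fst_child : ∀ e i, (child e i).fst = e.snd
  snd_ne : ∀ e i, (child e i).snd ≠ e.fst
  inj : ∀ e i j, (child e i).snd = (child e j).snd → i = j
  surj : ∀ (e : G.Dart) z, G.Adj e.snd z → z ≠ e.fst → ∃ i, (child e i).snd = z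

theorem exists_childEnum [G.LocallyFinite] {d : ℕ} (hreg : G.IsRegularOfDegree (d + 1)) :
    Nonempty (ChildEnum G d) := by
  classical
  have key : ∀ e : G.Dart, Nonempty (Fin d ≃ {z // z ∈ (G.neighborFinset e.snd).erase e.fst}) := by
    intro e
    refine ⟨(Fintype.equivFinOfCardEq ?_).symm⟩
    rw [Fintype.card_coe, Finset.card_erase_of_mem, G.card_neighborFinset_eq_degree, hreg e.snd]
    · simp
    · simpa using e.adj.symm
  let f := fun e => (key e).some
  have hmem : ∀ e i, G.Adj e.snd (f e i).1 ∧ (f e i).1 ≠ e.fst := by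
    intro e i
    have := (f e i).2
    simp only [Finset.mem_erase, SimpleGraph.mem_neighborFinset] at this
    exact ⟨this.2, this.1⟩
  refine ⟨⟨fun e i => ⟨(e.snd, (f e i).1), (hmem e i).1⟩, fun e i => rfl, fun e i => (hmem e i).2,
    fun e i j h => (f e).injective (Subtype.ext h), fun e z hz hne => ?_⟩⟩
  refine ⟨(f e).symm ⟨z, by simp [hne, hz]⟩, by simp⟩

namespace ChildEnum

variable {d : ℕ} (ch : ChildEnum G d)

/-- The dart reached from `e` by following the continuations listed in a word. -/
def desc (e : G.Dart) : List (Fin d) → G.Dart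
  | [] => e
  | i :: w => desc (ch.child e i) w

/-- A walk in a tree that has started to move away from `u` keeps doing so as long as it does not
backtrack. -/
theorem dist_desc (hT : G.IsTree) (u : V) (w : List (Fin d)) : ∀ e : G.Dart,
    G.dist u e.snd = G.dist u e.fst + 1 →
    G.dist u (ch.desc e w).fst = G.dist u e.fst + w.length ∧
    G.dist u (ch.desc e w).snd = G.dist u e.fst + w.length + 1 := by
  induction w with
  | nil => intro e he; simp [desc, he]
  | cons i w ih =>
    intro e he
    have h1 : G.dist u (ch.child e i).snd = G.dist u (ch.child e i).fst + 1 := by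
      have hadj := (ch.child e i).adj
      rw [ch.fst_child] at hadj ⊢
      exact dist_eq_add_one_of_ne hT e.adj hadj (ch.snd_ne e i).symm he
    have := ih _ h1
    rw [ch.fst_child, he] at this
    simp only [desc, List.length_cons]
    omega

theorem dist_fst_desc (hT : G.IsTree) (e : G.Dart) (w : List (Fin d)) :
    G.dist e.fst (ch.desc e w).fst = w.length ∧
    G.dist e.fst (ch.desc e w).snd = w.length + 1 := by
  have := ch.dist_desc hT e.fst w e (by simp [SimpleGraph.dist_eq_one_iff_adj.2 e.adj])
  simpa using this

/-- Points of the tree beyond two different continuations are separated by their base point. -/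
theorem dist_desc_child_of_ne (hT : G.IsTree) (e : G.Dart) {i j : Fin d} (hij : i ≠ j) {u : V}
    (hu : G.dist u e.snd = G.dist u (ch.child e i).snd + 1) (w : List (Fin d)) :
    G.dist u (ch.desc (ch.child e j) w).fst = G.dist u e.snd + w.length ∧
    G.dist u (ch.desc (ch.child e j) w).snd = G.dist u e.snd + (w.length + 1) := by
  have hai := (ch.child e i).adj
  have haj := (ch.child e j).adj
  rw [ch.fst_child] at hai haj
  have h1 := dist_eq_add_one_of_ne hT hai.symm haj (fun h => hij (ch.inj e i j h)) hu
  have := ch.dist_desc hT u w (ch.child e j) (by rw [ch.fst_child, h1])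
  rw [ch.fst_child] at this
  exact ⟨this.1, by rw [this.2]; ring⟩

end ChildEnum

theorem finite_setOf_dist_eq [G.LocallyFinite] (hG : G.Connected) (o : V) (n : ℕ) :
    {v | G.dist o v = n}.Finite := by
  induction n with
  | zero =>
    refine (Set.finite_singleton o).subset fun v hv => ?_
    exact ((hG.dist_eq_zero_iff).1 hv).symm
  | succ n ih =>
    refine (ih.biUnion fun u _ => (G.neighborSet u).toFinite).subset fun v hv => ?_
    have hv : G.dist o v = n + 1 := hv
    obtain ⟨w, hwv, hw⟩ := exists_adj_dist_add_one hG (o := o) (v := v) (by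
      rintro rfl
      rw [SimpleGraph.dist_self] at hv
      omega)
    simp only [mem_iUnion, mem_ofPred_eq, SimpleGraph.mem_neighborSet]
    exact ⟨w, by omega, hwv⟩

/-- Spheres are finite. Countability lets almost sure statements about single darts hold
simultaneously. -/
theorem countable_of_locallyFinite [G.LocallyFinite] (hG : G.Connected) : Countable V := by
  obtain ⟨o⟩ := hG.nonempty
  have : (univ : Set V) = ⋃ n : ℕ, {v | G.dist o v = n} := by ext; simp
  rw [← Set.countable_univ_iff, this]
  exact Set.countable_iUnion fun n => (finite_setOf_dist_eq hG o n).countable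

/-! ### Points of the cable system -/

theorem edgePt_apply_fst {x y : V} (h : G.Adj x y) {t : ℝ} (ht : t ∈ Icc (0 : ℝ) 1) :
    (edgePt h t).1 x = 1 - t := by
  simp [edgePt, ht.1, ht.2]

theorem edgePt_apply_snd {x y : V} (h : G.Adj x y) {t : ℝ} (ht : t ∈ Icc (0 : ℝ) 1) :
    (edgePt h t).1 y = t := by
  simp [edgePt, ht.1, ht.2, h.ne']

theorem edgePt_apply_of_ne {x y : V} (h : G.Adj x y) (t : ℝ) {v : V} (hx : v ≠ x) (hy : v ≠ y) :
    (edgePt h t).1 v = 0 := by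
  simp [edgePt, hx, hy]

theorem edgePt_eq_iff {x y : V} (h : G.Adj x y) {t : ℝ} (ht : t ∈ Icc (0 : ℝ) 1)
    (p : CableSystem G) : edgePt h t = p ↔ p.1 x = 1 - t ∧ p.1 y = t ∧
      ∀ v, v ≠ x → v ≠ y → p.1 v = 0 := by
  constructor
  · rintro rfl
    exact ⟨edgePt_apply_fst h ht, edgePt_apply_snd h ht, fun v => edgePt_apply_of_ne h t⟩
  · rintro ⟨hx, hy, h0⟩
    ext v
    by_cases hvx : v = x
    · subst hvx; rw [edgePt_apply_fst h ht, hx]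
    by_cases hvy : v = y
    · subst hvy; rw [edgePt_apply_snd h ht, hy]
    rw [edgePt_apply_of_ne h t hvx hvy, h0 v hvx hvy]

theorem exists_eq_edgePt (p : CableSystem G) :
    ∃ x y, ∃ h : G.Adj x y, ∃ t ∈ Icc (0 : ℝ) 1, p = edgePt h t := by
  obtain ⟨x, y, h, h1, h0⟩ := p.2.2
  have hx := p.2.1 x
  have hy := p.2.1 y
  have ht : p.1 y ∈ Icc (0 : ℝ) 1 := ⟨hy, by linarith⟩
  exact ⟨x, y, h, p.1 y, ht, ((edgePt_eq_iff h ht p).2 ⟨by linarith, rfl, h0⟩).symm⟩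

theorem edgePt_symm {x y : V} (h : G.Adj x y) (t : ℝ) : edgePt h.symm (1 - t) = edgePt h t := by
  have hc : max 0 (min 1 (1 - t)) = 1 - max 0 (min 1 t) := by
    rcases le_total t 0 with h0 | h0 <;> rcases le_total t 1 with h1 | h1 <;>
      simp [h0, h1]
    linarith
  ext v
  simp only [edgePt, hc]
  by_cases hvx : v = x
  · subst hvx; simp [h.ne]
  · by_cases hvy : v = y
    · subst hvy; simp [hvx]
    · simp [hvx, hvy]

theorem edgePt_injOn {x y : V} (h : G.Adj x y) : InjOn (edgePt h) (Icc (0 : ℝ) 1) := by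
  intro s hs t ht hst
  rw [← edgePt_apply_snd h hs, ← edgePt_apply_snd h ht, hst]

theorem edgePt_zero_eq {x y y' : V} (h : G.Adj x y) (h' : G.Adj x y') :
    edgePt h 0 = edgePt h' 0 := by
  rw [edgePt_eq_iff h (by simp)]
  refine ⟨by rw [edgePt_apply_fst _ (by simp)], ?_, fun v hx _ => ?_⟩
  · by_cases hy : y = y'
    · subst hy; rw [edgePt_apply_snd _ (by simp)]
    · rw [edgePt_apply_of_ne _ _ h.ne' hy]
  · by_cases hy : v = y'
    · subst hy; rw [edgePt_apply_snd _ (by simp)]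
    · rw [edgePt_apply_of_ne _ _ hx hy]

/-- The extension of a function on vertices which is affine on every segment. -/
def lin (f : V → ℝ) (p : CableSystem G) : ℝ := ∑ᶠ v, p.1 v * f v

theorem lin_edgePt (f : V → ℝ) {x y : V} (h : G.Adj x y) {t : ℝ} (ht : t ∈ Icc (0 : ℝ) 1) :
    lin f (edgePt h t) = (1 - t) * f x + t * f y := by
  classical
  have hsub : (Function.support fun v => (edgePt h t).1 v * f v) ⊆ (({x, y} : Finset V) : Set V) := by
    intro v hv
    by_contra hn
    simp only [Finset.coe_insert, Finset.coe_singleton, mem_insert_iff, mem_singleton_iff,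
      not_or] at hn
    exact hv (by simp [edgePt_apply_of_ne h t hn.1 hn.2])
  rw [lin, finsum_eq_sum_of_support_subset _ hsub, Finset.sum_pair h.ne, edgePt_apply_fst h ht,
    edgePt_apply_snd h ht]

theorem lin_edgePt_zero (f : V → ℝ) {x y : V} (h : G.Adj x y) : lin f (edgePt h 0) = f x := by
  rw [lin_edgePt f h (by simp)]; ring

/-! ### Slopes of functions affine on a piece of a segment -/

/-- The factor `2` is the inverse of `edgeLength`: it converts slopes in the fraction `t` into
slopes in length. -/
theorem outSlope_of_affine {h : CableSystem G → ℝ} {x y : V} (hxy : G.Adj x y) {a b α β t : ℝ}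
    (hh : ∀ t ∈ Icc a b, h (edgePt hxy t) = α + β * t) (ht : t ∈ Ico a b) :
    outSlope h hxy t = 2 * β := by
  have hd : HasDerivWithinAt (fun s => h (edgePt hxy s)) β (Ioi t) t := by
    have h1 : HasDerivWithinAt (fun s : ℝ => α + β * s) β (Ioi t) t := by
      simpa using (((hasDerivAt_id t).const_mul β).const_add α).hasDerivWithinAt
    refine h1.congr_of_eventuallyEq ?_ (hh t ⟨ht.1, ht.2.le⟩)
    filter_upwards [Ioo_mem_nhdsGT ht.2] with s hs
    exact hh s ⟨ht.1.trans hs.1.le, hs.2.le⟩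
  rw [outSlope, hd.derivWithin (uniqueDiffWithinAt_Ioi t), edgeLength]
  ring

theorem outSlope_symm_of_affine {h : CableSystem G → ℝ} {x y : V} (hxy : G.Adj x y)
    {a b α β t : ℝ} (hh : ∀ t ∈ Icc a b, h (edgePt hxy t) = α + β * t) (ht : t ∈ Ioc a b) :
    outSlope h hxy.symm (1 - t) = -(2 * β) := by
  have h1 : ∀ u ∈ Icc (1 - b) (1 - a), h (edgePt hxy.symm u) = (α + β) + (-β) * u := by
    intro u hu
    have h2 := edgePt_symm hxy (1 - u)
    rw [sub_sub_cancel] at h2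
    rw [h2, hh (1 - u) ⟨by linarith [hu.2], by linarith [hu.1]⟩]
    ring
  rw [outSlope_of_affine hxy.symm h1 ⟨by linarith [ht.2], by linarith [ht.1]⟩]
  ring

/-! ### Comparison of fundamental solutions -/

/-- Both functions have the same kink at a pole inside the segment, so it cancels in the difference.
-/
theorem IsFundamentalSolution.sub_affine [G.LocallyFinite] {z : CableSystem G}
    {h k : CableSystem G → ℝ} (hh : IsFundamentalSolution G z h)
    (hk : IsFundamentalSolution G z k) {x y : V} (hxy : G.Adj x y) :
    ∃ α β : ℝ, (∀ t ∈ Icc (0 : ℝ) 1, h (edgePt hxy t) - k (edgePt hxy t) = α + β * t) ∧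
      outSlope h hxy 0 - outSlope k hxy 0 = 2 * β := by
  by_cases hz : ∃ t ∈ Ioo (0 : ℝ) 1, edgePt hxy t = z
  · obtain ⟨s, hs, hsz⟩ := hz
    have hne1 : ∀ t ∈ Ioo 0 s, edgePt hxy t ≠ z := fun t ht h => by
      have := edgePt_injOn hxy ⟨ht.1.le, by linarith [ht.2, hs.2]⟩ ⟨hs.1.le, hs.2.le⟩
        (h.trans hsz.symm)
      exact ht.2.ne this
    have hne2 : ∀ t ∈ Ioo s 1, edgePt hxy t ≠ z := fun t ht h => by
      have := edgePt_injOn hxy ⟨by linarith [ht.1, hs.1], ht.2.le⟩ ⟨hs.1.le, hs.2.le⟩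
        (h.trans hsz.symm)
      exact ht.1.ne' this
    obtain ⟨a, b, hab⟩ := hh.affine hxy 0 s le_rfl hs.1.le hs.2.le hne1
    obtain ⟨a', b', hab'⟩ := hh.affine hxy s 1 hs.1.le hs.2.le le_rfl hne2
    obtain ⟨p, q, hpq⟩ := hk.affine hxy 0 s le_rfl hs.1.le hs.2.le hne1
    obtain ⟨p', q', hpq'⟩ := hk.affine hxy s 1 hs.1.le hs.2.le le_rfl hne2
    have i1 := hh.interior hxy s hs
    have i2 := hk.interior hxy s hs
    rw [if_pos hsz, outSlope_of_affine hxy hab' ⟨le_rfl, hs.2⟩,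
      outSlope_symm_of_affine hxy hab ⟨hs.1, le_rfl⟩] at i1
    rw [if_pos hsz, outSlope_of_affine hxy hpq' ⟨le_rfl, hs.2⟩,
      outSlope_symm_of_affine hxy hpq ⟨hs.1, le_rfl⟩] at i2
    have j1 := (hab s ⟨hs.1.le, le_rfl⟩).symm.trans (hab' s ⟨le_rfl, hs.2.le⟩)
    have j2 := (hpq s ⟨hs.1.le, le_rfl⟩).symm.trans (hpq' s ⟨le_rfl, hs.2.le⟩)
    refine ⟨a - p, b - q, fun t ht => ?_, ?_⟩
    · rcases le_total t s with hts | hts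
      · rw [hab t ⟨ht.1, hts⟩, hpq t ⟨ht.1, hts⟩]; ring
      · rw [hab' t ⟨hts, ht.2⟩, hpq' t ⟨hts, ht.2⟩]
        have e1 : b' - q' = b - q := by linarith
        have e2 : a' - p' = a - p := by
          have : (b' - q') * s = (b - q) * s := by rw [e1]
          linarith
        linear_combination e2 + t * e1
    · rw [outSlope_of_affine hxy hab ⟨le_rfl, hs.1⟩, outSlope_of_affine hxy hpq ⟨le_rfl, hs.1⟩]
      ring
  · push Not at hz
    obtain ⟨a, b, hab⟩ := hh.affine hxy 0 1 le_rfl zero_le_one le_rfl hz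
    obtain ⟨p, q, hpq⟩ := hk.affine hxy 0 1 le_rfl zero_le_one le_rfl hz
    refine ⟨a - p, b - q, fun t ht => ?_, ?_⟩
    · rw [hab t ht, hpq t ht]; ring
    · rw [outSlope_of_affine hxy hab ⟨le_rfl, one_pos⟩, outSlope_of_affine hxy hpq ⟨le_rfl, one_pos⟩]
      ring

/-- The pole disappears in the difference, whether it is a vertex or not, and the Kirchhoff
conditions become discrete harmonicity. -/
theorem IsFundamentalSolution.exists_harmonic [G.LocallyFinite] {z : CableSystem G}
    {h k : CableSystem G → ℝ} (hh : IsFundamentalSolution G z h)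
    (hk : IsFundamentalSolution G z k) (hdeg : ∀ v : V, ∃ w, G.Adj v w) :
    ∃ f : V → ℝ, (∀ p, h p - k p = lin f p) ∧
      ∀ x, ∑ y : G.neighborSet x, (f y - f x) = 0 := by
  choose nb hnb using hdeg
  set f : V → ℝ := fun v => h (edgePt (hnb v) 0) - k (edgePt (hnb v) 0) with hf
  have hf0 : ∀ {x y : V} (hxy : G.Adj x y), h (edgePt hxy 0) - k (edgePt hxy 0) = f x := by
    intro x y hxy
    simp only [hf, edgePt_zero_eq hxy (hnb x)]
  have hf1 : ∀ {x y : V} (hxy : G.Adj x y), h (edgePt hxy 1) - k (edgePt hxy 1) = f y := by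
    intro x y hxy
    rw [← hf0 hxy.symm, ← edgePt_symm hxy 1, sub_self]
  have hedge : ∀ {x y : V} (hxy : G.Adj x y),
      (∀ t ∈ Icc (0 : ℝ) 1, h (edgePt hxy t) - k (edgePt hxy t) = (1 - t) * f x + t * f y) ∧
      outSlope h hxy 0 - outSlope k hxy 0 = 2 * (f y - f x) := by
    intro x y hxy
    obtain ⟨α, β, h1, h2⟩ := hh.sub_affine hk hxy
    have e0 := (hf0 hxy).symm.trans (h1 0 (by simp))
    have e1 := (hf1 hxy).symm.trans (h1 1 (by simp))
    have eα : α = f x := by linarith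
    have eβ : β = f y - f x := by linarith
    subst eα
    refine ⟨fun t ht => ?_, by rw [h2, eβ]⟩
    rw [h1 t ht, eβ]; ring
  refine ⟨f, fun p => ?_, fun x => ?_⟩
  · obtain ⟨x, y, hxy, t, ht, rfl⟩ := exists_eq_edgePt p
    rw [(hedge hxy).1 t ht, lin_edgePt f hxy ht]
  · have := (hh.vertex x).trans (hk.vertex x).symm
    have h2 : ∑ y : G.neighborSet x, (outSlope h y.2 0 - outSlope k y.2 0) = 0 := by
      rw [Finset.sum_sub_distrib]; linarith
    rw [Finset.sum_congr rfl fun y _ => (hedge y.2).2, ← Finset.mul_sum] at h2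
    linarith

/-! ### The Green function of the regular tree -/

/-- The Green function of the walk on the vertices of the `(d + 1)`-regular tree, on the
diagonal. -/
def diagGreen (d : ℕ) : ℝ := d / ((d : ℝ) ^ 2 - 1)

/-- The Green function of the walk on the vertices of the `(d + 1)`-regular tree. -/
def vertexGreen (G : SimpleGraph V) (d : ℕ) (x v : V) : ℝ :=
  diagGreen d * ((d : ℝ)⁻¹) ^ G.dist x v

theorem diagGreen_pos {d : ℕ} (hd : 2 ≤ d) : 0 < diagGreen d := by
  have : (2 : ℝ) ≤ d := by exact_mod_cast hd
  exact div_pos (by linarith) (by nlinarith)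

/-- This is the condition at the pole: the function drops by `diagGreen d * (1 - d⁻¹)` along each of
`d + 1` edges, and the total drop is `1`. -/
theorem diagGreen_eq {d : ℕ} (hd : 2 ≤ d) : diagGreen d * (1 - (d : ℝ)⁻¹) * (d + 1) = 1 := by
  have : (2 : ℝ) ≤ d := by exact_mod_cast hd
  have h1 : (d : ℝ) ^ 2 - 1 ≠ 0 := by nlinarith
  have h2 : (d : ℝ) ≠ 0 := by linarith
  rw [diagGreen]
  field_simp
  ring

theorem vertexGreen_nonneg {d : ℕ} (hd : 2 ≤ d) (x v : V) : 0 ≤ vertexGreen G d x v :=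
  mul_nonneg (diagGreen_pos hd).le (by positivity)

theorem vertexGreen_lt (hG : G.Connected) {d : ℕ} (hd : 2 ≤ d) (x o : V) {ε : ℝ} (hε : 0 < ε) :
    ∃ N : ℕ, ∀ v, N ≤ G.dist o v → vertexGreen G d x v < ε := by
  have hd' : (2 : ℝ) ≤ d := by exact_mod_cast hd
  have hq1 : (d : ℝ)⁻¹ < 1 := inv_lt_one_of_one_lt₀ (by linarith)
  have hq0 : 0 ≤ (d : ℝ)⁻¹ := by positivity
  obtain ⟨n, hn⟩ := exists_pow_lt_of_lt_one (div_pos hε (diagGreen_pos hd)) hq1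
  refine ⟨G.dist o x + n, fun v hv => ?_⟩
  have h1 : n ≤ G.dist x v := by
    have := hG.dist_triangle (u := o) (v := x) (w := v)
    omega
  have h2 : ((d : ℝ)⁻¹) ^ G.dist x v ≤ ((d : ℝ)⁻¹) ^ n := pow_le_pow_of_le_one hq0 hq1.le h1
  calc vertexGreen G d x v ≤ diagGreen d * ((d : ℝ)⁻¹) ^ n :=
        mul_le_mul_of_nonneg_left h2 (diagGreen_pos hd).le
    _ < diagGreen d * (ε / diagGreen d) := mul_lt_mul_of_pos_left hn (diagGreen_pos hd)
    _ = ε := by field_simp [(diagGreen_pos hd).ne']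

-- Away from the pole, one neighbour carries `d` times the value and the `d` others carry `d⁻¹`
-- times the value, which adds up to `d + 1` times the value.
open Classical in
theorem sum_vertexGreen [G.LocallyFinite] {d : ℕ} (hd : 2 ≤ d) (hT : G.IsTree)
    (hreg : G.IsRegularOfDegree (d + 1)) (x u : V) :
    ∑ v : G.neighborSet u, (vertexGreen G d x v - vertexGreen G d x u) =
      if u = x then -1 else 0 := by
  have hd' : (2 : ℝ) ≤ d := by exact_mod_cast hd
  have hd0 : (d : ℝ) ≠ 0 := by linarith
  have key := diagGreen_eq hd
  rw [← Finset.sum_subtype (G.neighborFinset u) (fun v => by simp)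
    (fun v => vertexGreen G d x v - vertexGreen G d x u)]
  have hcard : (G.neighborFinset u).card = d + 1 := by
    rw [G.card_neighborFinset_eq_degree, hreg u]
  split_ifs with hux
  · subst hux
    rw [Finset.sum_congr rfl (g := fun _ => diagGreen d * ((d : ℝ)⁻¹ - 1)), Finset.sum_const, hcard]
    · rw [nsmul_eq_mul]; push_cast; linarith
    · intro v hv
      rw [SimpleGraph.mem_neighborFinset] at hv
      rw [vertexGreen, vertexGreen, SimpleGraph.dist_eq_one_iff_adj.2 hv, SimpleGraph.dist_self]
      ring
  · obtain ⟨p, hadj, hp⟩ := exists_adj_dist_add_one hT.connected (Ne.symm hux)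
    have hpd : G.dist x u = G.dist x p + 1 := hp.symm
    have hmem : p ∈ G.neighborFinset u := by
      simpa using hadj.symm
    rw [← Finset.add_sum_erase _ _ hmem, Finset.sum_congr rfl
      (g := fun _ => vertexGreen G d x u * ((d : ℝ)⁻¹ - 1)), Finset.sum_const,
      Finset.card_erase_of_mem hmem, hcard]
    · rw [vertexGreen, vertexGreen, hpd, nsmul_eq_mul, pow_succ]
      push_cast
      field_simp
      ring
    · intro v hv
      rw [Finset.mem_erase, SimpleGraph.mem_neighborFinset] at hv
      rw [vertexGreen, vertexGreen, dist_eq_add_one_of_ne hT hadj hv.2 (Ne.symm hv.1) hpd]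
      ring

theorem exists_adj_of_regular [G.LocallyFinite] {d : ℕ} (hreg : G.IsRegularOfDegree (d + 1))
    (v : V) : ∃ w, G.Adj v w := by
  rw [← SimpleGraph.degree_pos_iff_exists_adj, hreg v]
  omega

/-- By harmonicity a neighbour that is not lower must be balanced among the remaining `d` ones. This
lets a descent continue without backtracking. -/
theorem exists_adj_ne_of_regular [G.LocallyFinite] {d : ℕ} (hd : 2 ≤ d)
    (hreg : G.IsRegularOfDegree (d + 1)) (f : V → ℝ)
    (hf : ∀ x, ∑ y : G.neighborSet x, (f y - f x) = 0) (u p : V) (hp : f u ≤ f p)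
    (hup : G.Adj u p) : ∃ v, G.Adj u v ∧ v ≠ p ∧ f v ≤ f u := by
  classical
  have h0 := hf u
  rw [← Finset.sum_subtype (G.neighborFinset u) (fun v => by simp) (fun v => f v - f u)] at h0
  have hmem : p ∈ G.neighborFinset u := by simpa using hup
  rw [← Finset.add_sum_erase _ _ hmem] at h0
  by_contra! hcon
  have : 0 < ∑ v ∈ (G.neighborFinset u).erase p, (f v - f u) := by
    refine Finset.sum_pos (fun v hv => ?_) ?_
    · rw [Finset.mem_erase, SimpleGraph.mem_neighborFinset] at hv
      linarith [hcon v hv.2 hv.1]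
    · rw [← Finset.card_pos, Finset.card_erase_of_mem hmem, G.card_neighborFinset_eq_degree,
        hreg u]
      omega
  linarith

/-- A function on the vertices of a regular tree which is harmonic, and asymptotically nonnegative,
is nonnegative. -/
theorem nonneg_of_harmonic [G.LocallyFinite] {d : ℕ} (hd : 2 ≤ d) (hT : G.IsTree)
    (hreg : G.IsRegularOfDegree (d + 1)) (f : V → ℝ)
    (hf : ∀ x, ∑ y : G.neighborSet x, (f y - f x) = 0)
    (hlim : ∀ o : V, ∀ ε > 0, ∃ N : ℕ, ∀ v, N ≤ G.dist o v → -ε < f v) (o : V) : 0 ≤ f o := by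
  by_contra! hneg
  -- Darts at every distance from `o` are reached without backtracking and without `f` ever
  -- increasing, so `f` stays at or below `f o < 0` arbitrarily far away.
  have step : ∀ n : ℕ, ∃ e : G.Dart, G.dist o e.snd = G.dist o e.fst + 1 ∧
      G.dist o e.fst = n ∧ f e.snd ≤ f e.fst ∧ f e.fst ≤ f o := by
    intro n
    induction n with
    | zero =>
      obtain ⟨p, hp⟩ := exists_adj_of_regular hreg o
      obtain ⟨v, hv, hvo⟩ : ∃ v, G.Adj o v ∧ f v ≤ f o := by
        by_cases hpo : f p ≤ f o
        · exact ⟨p, hp, hpo⟩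
        · obtain ⟨v, hv, -, h⟩ := exists_adj_ne_of_regular hd hreg f hf o p (not_le.1 hpo).le hp
          exact ⟨v, hv, h⟩
      exact ⟨⟨(o, v), hv⟩, by simp [SimpleGraph.dist_eq_one_iff_adj.2 hv], by simp, hvo, le_rfl⟩
    | succ n ih =>
      obtain ⟨e, h1, h2, h3, h4⟩ := ih
      obtain ⟨v, hv, hne, hle⟩ :=
        exists_adj_ne_of_regular hd hreg f hf e.snd e.fst h3 e.adj.symm
      exact ⟨⟨(e.snd, v), hv⟩, dist_eq_add_one_of_ne hT e.adj hv hne.symm h1, by simp [h1, h2],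
        hle, h3.trans h4⟩
  obtain ⟨N, hN⟩ := hlim o (-f o) (by linarith)
  obtain ⟨e, -, h2, -, h4⟩ := step N
  have := hN e.fst h2.ge
  linarith

/-- The explicit form of the Green function of the cable system of the `(d + 1)`-regular tree, with
pole at the point at fraction `s` of the way from `x` to `y`. -/
def cableGreen (G : SimpleGraph V) (d : ℕ) (x y : V) (s : ℝ) (w : CableSystem G) : ℝ :=
  (1 - s) * lin (vertexGreen G d x) w + s * lin (vertexGreen G d y) w +
    min (1 - s) (w.1 x) * min s (w.1 y)

theorem cableGreen_symm (d : ℕ) (x y : V) (s : ℝ) (w : CableSystem G) :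
    cableGreen G d y x (1 - s) w = cableGreen G d x y s w := by
  simp only [cableGreen, sub_sub_cancel]; ring

theorem cableGreen_zero (d : ℕ) (x y : V) (w : CableSystem G) :
    cableGreen G d x y 0 w = lin (vertexGreen G d x) w := by
  simp [cableGreen, w.2.1 y]

theorem lin_nonneg {f : V → ℝ} (hf : ∀ v, 0 ≤ f v) (p : CableSystem G) : 0 ≤ lin f p :=
  finsum_nonneg fun v => mul_nonneg (p.2.1 v) (hf v)

theorem cableGreen_nonneg {d : ℕ} (hd : 2 ≤ d) (x y : V) {s : ℝ} (hs : s ∈ Icc (0 : ℝ) 1)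
    (w : CableSystem G) : 0 ≤ cableGreen G d x y s w := by
  have h1 : 0 ≤ 1 - s := by linarith [hs.2]
  have hx := lin_nonneg (vertexGreen_nonneg (G := G) hd x) w
  have hy := lin_nonneg (vertexGreen_nonneg (G := G) hd y) w
  have := mul_nonneg (le_min h1 (w.2.1 x)) (le_min hs.1 (w.2.1 y))
  have := mul_nonneg h1 hx
  have := mul_nonneg hs.1 hy
  rw [cableGreen]
  linarith

theorem affine_of_lin {h : CableSystem G → ℝ} {f : V → ℝ} {x y : V} (hxy : G.Adj x y)
    (hh : ∀ t ∈ Icc (0 : ℝ) 1, h (edgePt hxy t) = lin f (edgePt hxy t)) :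
    ∀ t ∈ Icc (0 : ℝ) 1, h (edgePt hxy t) = f x + (f y - f x) * t := by
  intro t ht
  rw [hh t ht, lin_edgePt f hxy ht]; ring

theorem isFundamentalSolution_lin_vertexGreen [G.LocallyFinite] {d : ℕ} (hd : 2 ≤ d)
    (hT : G.IsTree) (hreg : G.IsRegularOfDegree (d + 1)) {x y : V} (hxy : G.Adj x y) :
    IsFundamentalSolution G (edgePt hxy 0) (lin (vertexGreen G d x)) := by
  classical
  have haff : ∀ {u v : V} (huv : G.Adj u v), ∀ t ∈ Icc (0 : ℝ) 1,
      lin (vertexGreen G d x) (edgePt huv t) = vertexGreen G d x u +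
        (vertexGreen G d x v - vertexGreen G d x u) * t :=
    fun huv => affine_of_lin huv fun t ht => rfl
  refine ⟨fun u v huv a b ha _ hb _ => ⟨_, _, fun t ht => haff huv t ⟨ha.trans ht.1, ht.2.trans hb⟩⟩,
    fun u => ?_, fun u v huv t ht => ?_⟩
  · rw [Finset.sum_congr rfl fun v _ => outSlope_of_affine v.2 (haff v.2) ⟨le_rfl, one_pos⟩,
      ← Finset.mul_sum, sum_vertexGreen hd hT hreg]
    by_cases hux : u = x
    · subst hux
      simp [edgePt_apply_fst hxy (t := 0) (by simp)]
    · have : (edgePt hxy 0).1 u ≠ 1 := by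
        by_cases huy : u = y
        · subst huy; simp [edgePt_apply_snd hxy (t := 0) (by simp)]
        · simp [edgePt_apply_of_ne hxy 0 hux huy]
      simp [hux, this]
  · rw [outSlope_of_affine huv (haff huv) ⟨ht.1.le, ht.2⟩,
      outSlope_symm_of_affine huv (haff huv) ⟨ht.1, ht.2.le⟩, if_neg, add_neg_cancel, mul_zero]
    intro h
    rw [edgePt_eq_iff huv ⟨ht.1.le, ht.2.le⟩] at h
    -- All weights of a vertex are `0` or `1`, so the pole is not interior to a segment.
    have key : ∀ w, (edgePt hxy 0).1 w = 0 ∨ (edgePt hxy 0).1 w = 1 := by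
      intro w
      by_cases hwx : w = x
      · subst hwx; right; simp [edgePt_apply_fst hxy (t := 0) (by simp)]
      · left
        by_cases hwy : w = y
        · subst hwy; simp [edgePt_apply_snd hxy (t := 0) (by simp)]
        · simp [edgePt_apply_of_ne hxy 0 hwx hwy]
    rcases key v with hv | hv
    · linarith [ht.1, h.2.1]
    · linarith [ht.2, h.2.1]

theorem edgePt_eq_edgePt_interior {x y u v : V} (hxy : G.Adj x y) (huv : G.Adj u v) {s t : ℝ}
    (hs : s ∈ Ioo (0 : ℝ) 1) (ht : t ∈ Ioo (0 : ℝ) 1) (h : edgePt huv t = edgePt hxy s) :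
    (u = x ∧ v = y ∧ t = s) ∨ (u = y ∧ v = x ∧ t = 1 - s) := by
  have hs' : s ∈ Icc (0 : ℝ) 1 := ⟨hs.1.le, hs.2.le⟩
  have ht' : t ∈ Icc (0 : ℝ) 1 := ⟨ht.1.le, ht.2.le⟩
  rw [edgePt_eq_iff huv ht'] at h
  have hne : ∀ w, (edgePt hxy s).1 w ≠ 0 → w = x ∨ w = y := by
    intro w hw
    by_contra! hcon
    exact hw (edgePt_apply_of_ne hxy s hcon.1 hcon.2)
  have hu := hne u (by rw [h.1]; linarith [ht.2])
  have hv := hne v (by rw [h.2.1]; exact ht.1.ne')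
  have huv' := huv.ne
  rcases hu with rfl | rfl <;> rcases hv with rfl | rfl
  · exact absurd rfl huv'
  · left; exact ⟨rfl, rfl, by rw [← h.2.1, edgePt_apply_snd hxy hs']⟩
  · right; exact ⟨rfl, rfl, by rw [← h.2.1, edgePt_apply_fst hxy hs']⟩
  · exact absurd rfl huv'

theorem cableGreen_congr (d : ℕ) {x y u v : V} (hxy : G.Adj x y) (huv : G.Adj u v) {s t : ℝ}
    (hs : s ∈ Ioo (0 : ℝ) 1) (ht : t ∈ Ioo (0 : ℝ) 1) (h : edgePt huv t = edgePt hxy s) :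
    cableGreen G d x y s = cableGreen G d u v t := by
  ext w
  rcases edgePt_eq_edgePt_interior hxy huv hs ht h with ⟨rfl, rfl, rfl⟩ | ⟨rfl, rfl, rfl⟩
  · rfl
  · rw [cableGreen_symm]

theorem cableGreen_edgePt_of_le (d : ℕ) {x y : V} (hxy : G.Adj x y) {s t : ℝ}
    (ht0 : 0 ≤ t) (hts : t ≤ s) (hs1 : s ≤ 1) :
    cableGreen G d x y s (edgePt hxy t) =
      ((1 - s) * vertexGreen G d x x + s * vertexGreen G d y x) +
        ((1 - s) * (vertexGreen G d x y - vertexGreen G d x x) +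
          s * (vertexGreen G d y y - vertexGreen G d y x) + (1 - s)) * t := by
  have ht : t ∈ Icc (0 : ℝ) 1 := ⟨ht0, hts.trans hs1⟩
  rw [cableGreen, lin_edgePt _ hxy ht, lin_edgePt _ hxy ht, edgePt_apply_fst hxy ht,
    edgePt_apply_snd hxy ht, min_eq_left (by linarith), min_eq_right hts]
  ring

theorem cableGreen_edgePt_of_ge (d : ℕ) {x y : V} (hxy : G.Adj x y) {s t : ℝ}
    (hs0 : 0 ≤ s) (hst : s ≤ t) (ht1 : t ≤ 1) :
    cableGreen G d x y s (edgePt hxy t) =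
      ((1 - s) * vertexGreen G d x x + s * vertexGreen G d y x + s) +
        ((1 - s) * (vertexGreen G d x y - vertexGreen G d x x) +
          s * (vertexGreen G d y y - vertexGreen G d y x) - s) * t := by
  have ht : t ∈ Icc (0 : ℝ) 1 := ⟨hs0.trans hst, ht1⟩
  rw [cableGreen, lin_edgePt _ hxy ht, lin_edgePt _ hxy ht, edgePt_apply_fst hxy ht,
    edgePt_apply_snd hxy ht, min_eq_right (by linarith), min_eq_left hst]
  ring

theorem cableGreen_edgePt_of_not_mem (d : ℕ) {x y u v : V} (hxy : G.Adj x y) (huv : G.Adj u v)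
    {s : ℝ} (hs : s ∈ Icc (0 : ℝ) 1) (hne : ¬ (u = x ∧ v = y)) (hne' : ¬ (u = y ∧ v = x)) {t : ℝ}
    (ht : t ∈ Icc (0 : ℝ) 1) :
    cableGreen G d x y s (edgePt huv t) =
      ((1 - s) * vertexGreen G d x u + s * vertexGreen G d y u) +
        ((1 - s) * (vertexGreen G d x v - vertexGreen G d x u) +
          s * (vertexGreen G d y v - vertexGreen G d y u)) * t := by
  have h0 : (edgePt huv t).1 x = 0 ∨ (edgePt huv t).1 y = 0 := by
    by_contra! hcon
    have hmem : ∀ w, (edgePt huv t).1 w ≠ 0 → w = u ∨ w = v := by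
      intro w hw
      by_contra! hc
      exact hw (edgePt_apply_of_ne huv t hc.1 hc.2)
    have := hxy.ne
    rcases hmem x hcon.1 with rfl | rfl <;> rcases hmem y hcon.2 with rfl | rfl <;> simp_all
  have h1 : 0 ≤ 1 - s := by linarith [hs.2]
  have h2 : min (1 - s) ((edgePt huv t).1 x) * min s ((edgePt huv t).1 y) = 0 := by
    rcases h0 with h0 | h0 <;> simp [h0, hs.1, h1]
  rw [cableGreen, h2, lin_edgePt _ huv ht, lin_edgePt _ huv ht]
  ring

-- The last two terms come from the bridge covariance on the segment of the pole. In the sum over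
-- neighbours they cancel the poles of the two vertex Green functions at `x` and `y`.
open Classical in
theorem cableGreen_outSlope_zero (d : ℕ) {x y u v : V} (hxy : G.Adj x y) (huv : G.Adj u v)
    {s : ℝ} (hs : s ∈ Ioo (0 : ℝ) 1) :
    outSlope (cableGreen G d x y s) huv 0 =
      2 * ((1 - s) * (vertexGreen G d x v - vertexGreen G d x u) +
          s * (vertexGreen G d y v - vertexGreen G d y u) +
          (if u = x ∧ v = y then 1 - s else 0) + (if u = y ∧ v = x then s else 0)) := by
  by_cases h1 : u = x ∧ v = y
  · obtain ⟨rfl, rfl⟩ := h1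
    rw [outSlope_of_affine huv (fun t ht => cableGreen_edgePt_of_le d huv ht.1 ht.2 hs.2.le)
      ⟨le_rfl, hs.1⟩]
    simp [huv.ne]
  · by_cases h2 : u = y ∧ v = x
    · obtain ⟨rfl, rfl⟩ := h2
      have : cableGreen G d v u s = cableGreen G d u v (1 - s) := by
        ext w; rw [cableGreen_symm]
      rw [this, outSlope_of_affine huv (b := 1 - s)
        (fun t ht => cableGreen_edgePt_of_le d huv ht.1 ht.2 (by linarith [hs.1]))
        ⟨le_rfl, by linarith [hs.2]⟩]
      simp [huv.ne]
      ring
    · rw [outSlope_of_affine huv (fun t ht => cableGreen_edgePt_of_not_mem d hxy huv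
        ⟨hs.1.le, hs.2.le⟩ h1 h2 ht) ⟨le_rfl, one_pos⟩, if_neg h1, if_neg h2]
      ring

open Classical in
theorem sum_neighborSet_ite [G.LocallyFinite] {x y : V} (hxy : G.Adj x y) (u : V) (a : ℝ) :
    ∑ v : G.neighborSet u, (if u = x ∧ (v : V) = y then a else 0) = if u = x then a else 0 := by
  by_cases hux : u = x
  · subst hux
    rw [Finset.sum_eq_single (⟨y, hxy⟩ : G.neighborSet u)]
    · simp
    · intro b _ hb
      exact if_neg fun h => hb (Subtype.ext h.2)
    · simp
  · simp [hux]

theorem isFundamentalSolution_cableGreen [G.LocallyFinite] {d : ℕ} (hd : 2 ≤ d)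
    (hT : G.IsTree) (hreg : G.IsRegularOfDegree (d + 1)) {x y : V} (hxy : G.Adj x y) {s : ℝ}
    (hs : s ∈ Ioo (0 : ℝ) 1) :
    IsFundamentalSolution G (edgePt hxy s) (cableGreen G d x y s) := by
  classical
  have hs' : s ∈ Icc (0 : ℝ) 1 := ⟨hs.1.le, hs.2.le⟩
  have hnot : ∀ {u v : V} (huv : G.Adj u v), ¬ (∃ t ∈ Ioo (0 : ℝ) 1, edgePt huv t = edgePt hxy s) →
      ¬ (u = x ∧ v = y) ∧ ¬ (u = y ∧ v = x) := by
    intro u v huv h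
    constructor
    · rintro ⟨rfl, rfl⟩
      exact h ⟨s, hs, rfl⟩
    · rintro ⟨rfl, rfl⟩
      exact h ⟨1 - s, ⟨by linarith [hs.2], by linarith [hs.1]⟩, edgePt_symm hxy s⟩
  refine ⟨fun u v huv a b ha hab hb hz => ?_, fun u => ?_, fun u v huv t ht => ?_⟩
  · by_cases hex : ∃ t ∈ Ioo (0 : ℝ) 1, edgePt huv t = edgePt hxy s
    · obtain ⟨r, hr, hrs⟩ := hex
      rw [cableGreen_congr d hxy huv hs hr hrs]
      rcases le_or_gt r a with hra | hra
      · exact ⟨_, _, fun t ht => cableGreen_edgePt_of_ge d huv hr.1.le (hra.trans ht.1)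
          (ht.2.trans hb)⟩
      · rcases le_or_gt b r with hrb | hrb
        · exact ⟨_, _, fun t ht => cableGreen_edgePt_of_le d huv (ha.trans ht.1) (ht.2.trans hrb)
            hr.2.le⟩
        · exact absurd hrs (hz r ⟨hra, hrb⟩)
    · exact ⟨_, _, fun t ht => cableGreen_edgePt_of_not_mem d hxy huv hs' (hnot huv hex).1
        (hnot huv hex).2 ⟨ha.trans ht.1, ht.2.trans hb⟩⟩
  · rw [Finset.sum_congr rfl fun v _ => cableGreen_outSlope_zero d hxy v.2 hs, ← Finset.mul_sum,
      Finset.sum_add_distrib, Finset.sum_add_distrib, Finset.sum_add_distrib, ← Finset.mul_sum,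
      ← Finset.mul_sum, sum_vertexGreen hd hT hreg, sum_vertexGreen hd hT hreg,
      sum_neighborSet_ite hxy, sum_neighborSet_ite hxy.symm, if_neg (c := (edgePt hxy s).1 u = 1)]
    · by_cases hux : u = x <;> by_cases huy : u = y <;> simp only [hux, huy, if_true, if_false] <;>
        (try split_ifs) <;> ring
    · by_cases hux : u = x
      · subst hux
        rw [edgePt_apply_fst hxy hs']
        linarith [hs.1]
      · by_cases huy : u = y
        · subst huy
          rw [edgePt_apply_snd hxy hs']
          exact hs.2.ne
        · simp [edgePt_apply_of_ne hxy s hux huy]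
  · by_cases hex : ∃ r ∈ Ioo (0 : ℝ) 1, edgePt huv r = edgePt hxy s
    · obtain ⟨r, hr, hrs⟩ := hex
      rw [cableGreen_congr d hxy huv hs hr hrs, ← hrs]
      have hle := fun (t : ℝ) (ht : t ∈ Icc 0 r) =>
        cableGreen_edgePt_of_le d huv ht.1 ht.2 hr.2.le
      have hge := fun (t : ℝ) (ht : t ∈ Icc r 1) =>
        cableGreen_edgePt_of_ge d huv hr.1.le ht.1 ht.2
      have hinj : t ≠ r → edgePt huv t ≠ edgePt huv r := fun hne h =>
        hne (edgePt_injOn huv ⟨ht.1.le, ht.2.le⟩ ⟨hr.1.le, hr.2.le⟩ h)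
      rcases lt_trichotomy t r with htr | htr | htr
      · rw [outSlope_of_affine huv hle ⟨ht.1.le, htr⟩,
          outSlope_symm_of_affine huv hle ⟨ht.1, htr.le⟩, if_neg (hinj htr.ne)]
        ring
      · subst htr
        rw [outSlope_of_affine huv hge ⟨le_rfl, hr.2⟩,
          outSlope_symm_of_affine huv hle ⟨hr.1, le_rfl⟩, if_pos rfl]
        ring
      · rw [outSlope_of_affine huv hge ⟨htr.le, ht.2⟩,
          outSlope_symm_of_affine huv hge ⟨htr, ht.2.le⟩, if_neg (hinj htr.ne')]
        ring
    · have haff := fun (t : ℝ) (ht : t ∈ Icc (0 : ℝ) 1) =>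
        cableGreen_edgePt_of_not_mem d hxy huv hs' (hnot huv hex).1 (hnot huv hex).2 ht
      rw [outSlope_of_affine huv haff ⟨ht.1.le, ht.2⟩,
        outSlope_symm_of_affine huv haff ⟨ht.1, ht.2.le⟩, if_neg fun h => hex ⟨t, ht, h⟩]
      ring

/-- A nonnegative competitor minus the explicit solution is harmonic, and it is bounded below by
minus a function that decays at infinity. The minimum principle makes it nonnegative. -/
theorem green_eq_of_isFundamentalSolution [G.LocallyFinite] {d : ℕ} (hd : 2 ≤ d)
    (hT : G.IsTree) (hreg : G.IsRegularOfDegree (d + 1)) {z : CableSystem G} {x y : V} {s : ℝ}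
    (hs : s ∈ Icc (0 : ℝ) 1) (hxy : G.Adj x y)
    (hsol : IsFundamentalSolution G z (cableGreen G d x y s)) (w : CableSystem G) :
    green G z w = cableGreen G d x y s w := by
  refine IsLeast.csInf_eq ⟨⟨_, hsol, cableGreen_nonneg hd x y hs, rfl⟩, ?_⟩
  rintro r ⟨h, hh, hnn, rfl⟩
  obtain ⟨f, hf, hharm⟩ := hh.exists_harmonic hsol (exists_adj_of_regular hreg)
  have hf0 : ∀ v, 0 ≤ f v := by
    refine nonneg_of_harmonic hd hT hreg f hharm fun o ε hε => ?_
    obtain ⟨N, hN⟩ := vertexGreen_lt hT.connected hd x o hε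
    obtain ⟨N', hN'⟩ := vertexGreen_lt hT.connected hd y o hε
    -- The extra distance excludes `v = x` and `v = y`, so that the formula off the segment of the
    -- pole applies.
    refine ⟨N + N' + (G.dist o x + G.dist o y + 1), fun v hv => ?_⟩
    obtain ⟨u, huv⟩ := exists_adj_of_regular hreg v
    have e := hf (edgePt huv 0)
    rw [lin_edgePt_zero] at e
    have hvx : v ≠ x := by rintro rfl; omega
    have hvy : v ≠ y := by rintro rfl; omega
    have hb := cableGreen_edgePt_of_not_mem d hxy huv hs (fun h => hvx h.1) (fun h => hvy h.1)
      (t := 0) (by simp)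
    have b1 := hN v (by omega)
    have b2 := hN' v (by omega)
    have := hnn (edgePt huv 0)
    have hs1 : 0 ≤ 1 - s := by linarith [hs.2]
    have m1 := mul_le_mul_of_nonneg_left (le_max_left (vertexGreen G d x v) (vertexGreen G d y v)) hs1
    have m2 := mul_le_mul_of_nonneg_left (le_max_right (vertexGreen G d x v) (vertexGreen G d y v)) hs.1
    have m3 := max_lt b1 b2
    linarith
  have := lin_nonneg hf0 w
  linarith [hf w]

theorem green_edgePt [G.LocallyFinite] {d : ℕ} (hd : 2 ≤ d) (hT : G.IsTree)
    (hreg : G.IsRegularOfDegree (d + 1)) {x y : V} (hxy : G.Adj x y) {s : ℝ}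
    (hs : s ∈ Icc (0 : ℝ) 1) (w : CableSystem G) :
    green G (edgePt hxy s) w = cableGreen G d x y s w := by
  have h0 : ∀ {x y : V} (hxy : G.Adj x y), green G (edgePt hxy 0) w = cableGreen G d x y 0 w := by
    intro x y hxy
    refine green_eq_of_isFundamentalSolution hd hT hreg (by simp) hxy ?_ w
    have : cableGreen G d x y 0 = lin (vertexGreen G d x) := funext fun w => cableGreen_zero d x y w
    rw [this]
    exact isFundamentalSolution_lin_vertexGreen hd hT hreg hxy
  rcases hs.1.eq_or_lt with rfl | hs0
  · exact h0 hxy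
  rcases hs.2.eq_or_lt with rfl | hs1
  · rw [← edgePt_symm hxy, sub_self, h0 hxy.symm, ← cableGreen_symm, sub_zero]
  · exact green_eq_of_isFundamentalSolution hd hT hreg hs hxy
      (isFundamentalSolution_cableGreen hd hT hreg hxy ⟨hs0, hs1⟩) w

/-! ### The Green function at points addressed by words -/

/-- Addresses of the rational points of the tree growing out of a dart: a word and a position on the
segment that the word leads to. -/
abbrev Address (d : ℕ) : Type := List (Fin d) × Icc (0 : ℚ) 1

theorem unitRat_mem (q : Icc (0 : ℚ) 1) : ((q : ℚ) : ℝ) ∈ Icc (0 : ℝ) 1 :=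
  ⟨by exact_mod_cast q.2.1, by exact_mod_cast q.2.2⟩

/-- The value, at the point with address `a` in the tree growing out of a dart, of the Green function
with pole at the starting vertex of the dart. -/
def rootGreen {d : ℕ} (a : Address d) : ℝ :=
  diagGreen d * ((1 - (a.2 : ℚ)) * ((d : ℝ)⁻¹) ^ (a.1.length + 1) +
    (a.2 : ℚ) * ((d : ℝ)⁻¹) ^ a.1.length)

/-- The Green function between the points at fractions `s ≤ t` of a segment. -/
def segGreen (d : ℕ) (s t : ℝ) : ℝ := (diagGreen d - t / (d + 1)) * (1 + (d - 1) * s)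

namespace ChildEnum

variable {d : ℕ} (ch : ChildEnum G d)

/-- The point with a given address in the tree growing out of the dart `e`; the position on a segment
is measured towards the starting vertex of `e`. -/
def point (e : G.Dart) (a : Address d) : CableSystem G :=
  edgePt (ch.desc e a.1).adj.symm (a.2 : ℚ)

theorem point_cons (e : G.Dart) (i : Fin d) (w : List (Fin d)) (q : Icc (0 : ℚ) 1) :
    ch.point e (i :: w, q) = ch.point (ch.child e i) (w, q) := rfl

theorem point_child_one (e : G.Dart) (i : Fin d) :
    ch.point (ch.child e i) ([], 1) = ch.point e ([], 0) := by
  have h0 : ∀ {x y x' y' : V} (h : G.Adj x y) (h' : G.Adj x' y'), x = x' →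
      edgePt h 0 = edgePt h' 0 := by
    rintro x y x' y' h h' rfl
    exact edgePt_zero_eq h h'
  have h1 := edgePt_symm (ch.child e i).adj 0
  simp only [point, desc]
  simp only [sub_zero] at h1
  simpa using h1.trans (h0 _ e.adj.symm (ch.fst_child e i))

theorem dist_siblings (hT : G.IsTree) (e : G.Dart) {i j : Fin d} (hij : i ≠ j)
    (w w' : List (Fin d)) :
    G.dist (ch.desc (ch.child e i) w).snd (ch.desc (ch.child e j) w').snd
      = (w.length + 1) + (w'.length + 1) ∧
    G.dist (ch.desc (ch.child e i) w).snd (ch.desc (ch.child e j) w').fst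
      = (w.length + 1) + w'.length ∧
    G.dist (ch.desc (ch.child e i) w).fst (ch.desc (ch.child e j) w').snd
      = w.length + (w'.length + 1) ∧
    G.dist (ch.desc (ch.child e i) w).fst (ch.desc (ch.child e j) w').fst
      = w.length + w'.length := by
  have hi := ch.dist_fst_desc hT (ch.child e i) w
  have hj := ch.dist_fst_desc hT (ch.child e j) w'
  rw [ch.fst_child] at hi hj
  have hsnd : G.dist (ch.desc (ch.child e i) w).snd e.snd =
      G.dist (ch.desc (ch.child e i) w).snd (ch.child e i).snd + 1 := by
    rw [G.dist_comm, hi.2, G.dist_comm]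
    cases w with
    | nil => simp [desc]
    | cons k w =>
      have := (ch.dist_fst_desc hT (ch.child (ch.child e i) k) w).2
      rw [ch.fst_child] at this
      simp [desc, this]
  have h1 := ch.dist_desc_child_of_ne hT e hij hsnd w'
  rw [G.dist_comm (v := e.snd), hi.2] at h1
  refine ⟨h1.2, h1.1, ?_⟩
  cases w with
  | nil =>
    simp only [desc, ch.fst_child, List.length_nil, zero_add]
    exact ⟨hj.2, hj.1⟩
  | cons k w =>
    have h2 := (ch.dist_fst_desc hT (ch.child (ch.child e i) k) w).1
    rw [ch.fst_child] at h2
    have hfst : G.dist (ch.desc (ch.child e i) (k :: w)).fst e.snd =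
        G.dist (ch.desc (ch.child e i) (k :: w)).fst (ch.child e i).snd + 1 := by
      rw [G.dist_comm, hi.1, G.dist_comm]
      simp [desc, h2]
    have h3 := ch.dist_desc_child_of_ne hT e hij hfst w'
    rw [G.dist_comm (v := e.snd), hi.1] at h3
    exact ⟨h3.2, h3.1⟩

variable [G.LocallyFinite]

/-- The value is a function of `t` times a function of `s`, which is the covariance form of the
Markov property along a segment. -/
theorem green_segment (hd : 2 ≤ d) (hT : G.IsTree) (hreg : G.IsRegularOfDegree (d + 1))
    (e : G.Dart) {s t : Icc (0 : ℚ) 1} (hst : s ≤ t) :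
    green G (ch.point e ([], s)) (ch.point e ([], t)) = segGreen d (s : ℚ) (t : ℚ) := by
  have hst' : ((s : ℚ) : ℝ) ≤ ((t : ℚ) : ℝ) := by exact_mod_cast hst
  have hs := unitRat_mem s
  have ht := unitRat_mem t
  simp only [point, desc]
  rw [green_edgePt hd hT hreg _ hs, cableGreen_edgePt_of_ge d _ hs.1 hst' ht.2]
  have hd' : (2 : ℝ) ≤ d := by exact_mod_cast hd
  have h1 : (d : ℝ) ^ 2 - 1 ≠ 0 := by nlinarith
  have h2 : (d : ℝ) ≠ 0 := by linarith
  have h3 : (d : ℝ) + 1 ≠ 0 := by linarith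
  simp only [vertexGreen, SimpleGraph.dist_self, SimpleGraph.dist_eq_one_iff_adj.2 e.adj,
    SimpleGraph.dist_eq_one_iff_adj.2 e.adj.symm, segGreen, diagGreen]
  field_simp
  ring

/-- The head of `e` separates the segment from the tree of the child, so the Green function factors
through it. -/
theorem green_stub_child (hd : 2 ≤ d) (hT : G.IsTree) (hreg : G.IsRegularOfDegree (d + 1))
    (e : G.Dart) (s : Icc (0 : ℚ) 1) (i : Fin d) (a : Address d) :
    green G (ch.point e ([], s)) (ch.point (ch.child e i) a) =
      (diagGreen d - (s : ℚ) / (d + 1)) * rootGreen a / diagGreen d := by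
  have hs := unitRat_mem s
  obtain ⟨w, t⟩ := a
  have ht := unitRat_mem t
  have hf := ch.dist_fst_desc hT e (i :: w)
  have hs' := ch.dist_fst_desc hT (ch.child e i) w
  rw [ch.fst_child] at hs'
  simp only [desc, List.length_cons] at hf
  simp only [point, desc]
  rw [green_edgePt hd hT hreg _ hs, cableGreen_edgePt_of_not_mem d e.adj.symm _ hs _ _ ht]
  · have hd' : (2 : ℝ) ≤ d := by exact_mod_cast hd
    have h1 : (d : ℝ) ^ 2 - 1 ≠ 0 := by nlinarith
    have h2 : (d : ℝ) ≠ 0 := by linarith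
    have h3 : (d : ℝ) + 1 ≠ 0 := by linarith
    simp only [vertexGreen, hf, hs', rootGreen, diagGreen, pow_succ]
    field_simp
    ring
  · rintro ⟨h, -⟩
    have h1 := hf.2
    rw [h, SimpleGraph.dist_eq_one_iff_adj.2 e.adj] at h1
    omega
  · rintro ⟨h, -⟩
    have h1 := hf.2
    rw [h, SimpleGraph.dist_self] at h1
    omega

/-- Separation by the common starting vertex again; this is what makes siblings independent given
the value there. -/
theorem green_siblings (hd : 2 ≤ d) (hT : G.IsTree) (hreg : G.IsRegularOfDegree (d + 1))
    (e : G.Dart) {i j : Fin d} (hij : i ≠ j) (a b : Address d) :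
    green G (ch.point (ch.child e i) a) (ch.point (ch.child e j) b) =
      rootGreen a * rootGreen b / diagGreen d := by
  obtain ⟨w, s⟩ := a
  obtain ⟨w', t⟩ := b
  have hs := unitRat_mem s
  have ht := unitRat_mem t
  obtain ⟨h1, h2, h3, h4⟩ := ch.dist_siblings hT e hij w w'
  simp only [point]
  rw [green_edgePt hd hT hreg _ hs, cableGreen_edgePt_of_not_mem d
    (ch.desc (ch.child e i) w).adj.symm _ hs _ _ ht]
  · have := (diagGreen_pos hd).ne'
    simp only [vertexGreen, h1, h2, h3, h4, rootGreen, pow_add]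
    field_simp
    ring
  · rintro ⟨h, -⟩
    rw [h, SimpleGraph.dist_self] at h1
    omega
  · rintro ⟨h, -⟩
    rw [h, SimpleGraph.dist_self] at h3
    omega

end ChildEnum

/-! ### Centered Gaussian processes -/

section Gaussian

variable {Ω T : Type*} [MeasurableSpace Ω] {P : Measure Ω}

theorem covariance_eq_integral_mul [IsProbabilityMeasure P] {X Y : Ω → ℝ} (hX : MemLp X 2 P)
    (hY : MemLp Y 2 P) (h0 : ∫ ω, X ω ∂P = 0) : cov[X, Y; P] = ∫ ω, X ω * Y ω ∂P := by
  rw [covariance_eq_sub hX hY, h0, zero_mul, sub_zero]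
  rfl

/-- Jointly Gaussian families that are uncorrelated are independent, and `c a` is a regression
coefficient making the residual orthogonal to the second family. Both the Markov property and the
independence of siblings rest on this. -/
theorem indepFun_sub_of_integral_mul_eq {Z : T → Ω → ℝ} (hZ : IsGaussianProcess Z P)
    (h0 : ∀ t, ∫ ω, Z t ω ∂P = 0) {A B : Type*} (α α' : A → T) (c : A → ℝ) (β : B → T)
    (h : ∀ a b, ∫ ω, Z (α a) ω * Z (β b) ω ∂P = c a * ∫ ω, Z (α' a) ω * Z (β b) ω ∂P) :
    IndepFun (fun ω a => Z (α a) ω - c a * Z (α' a) ω) (fun ω b => Z (β b) ω) P := by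
  classical
  have := hZ.isProbabilityMeasure
  have hL : ∀ t, MemLp (Z t) 2 P := fun t => (hZ.hasGaussianLaw_eval t).memLp_two
  refine IsGaussianProcess.indepFun_of_covariance_eq_zero
    (X := fun a ω => Z (α a) ω - c a * Z (α' a) ω) (Y := fun b => Z (β b)) ?_ ?_ ?_ ?_
  · refine hZ.of_isGaussianProcess ?_
    rintro (a | b)
    · refine ⟨{α a, α' a}, ContinuousLinearMap.proj ⟨α a, by simp⟩ -
        c a • ContinuousLinearMap.proj ⟨α' a, by simp⟩, fun ω => ?_⟩
      simp
    · exact ⟨{β b}, ContinuousLinearMap.proj ⟨β b, by simp⟩, fun ω => by simp⟩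
  · exact fun a => (hZ.aemeasurable _).sub ((hZ.aemeasurable _).const_mul _)
  · exact fun b => hZ.aemeasurable _
  · intro a b
    rw [covariance_fun_sub_left (hL _) ((hL _).const_mul _) (hL _), covariance_const_mul_left,
      covariance_eq_integral_mul (hL _) (hL _) (h0 _),
      covariance_eq_integral_mul (hL _) (hL _) (h0 _), h, sub_self]

/-- On finite sets of indices, every linear form is Gaussian with mean zero and with variance a
quadratic form in the covariances, so the characteristic functions agree. -/
theorem map_eq_of_integral_mul_eq {X Y : T → Ω → ℝ} (hX : IsGaussianProcess X P)
    (hY : IsGaussianProcess Y P) (hX0 : ∀ t, ∫ ω, X t ω ∂P = 0) (hY0 : ∀ t, ∫ ω, Y t ω ∂P = 0)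
    (mX : ∀ t, Measurable (X t)) (mY : ∀ t, Measurable (Y t))
    (h : ∀ s t, ∫ ω, X s ω * X t ω ∂P = ∫ ω, Y s ω * Y t ω ∂P) :
    P.map (fun ω t => X t ω) = P.map (fun ω t => Y t ω) := by
  classical
  have := hX.isProbabilityMeasure
  rw [map_eq_iff_forall_finset_map_restrict_eq (measurable_pi_lambda _ mX).aemeasurable
    (measurable_pi_lambda _ mY).aemeasurable]
  intro I
  have hXI := (hX.hasGaussianLaw I)
  have hYI := (hY.hasGaussianLaw I)
  have := hXI.isGaussian_map
  have := hYI.isGaussian_map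
  have key : ∀ {Z : T → Ω → ℝ}, IsGaussianProcess Z P → (∀ t, ∫ ω, Z t ω ∂P = 0) →
      ∀ L : StrongDual ℝ (I → ℝ), (∫ ω, L (I.restrict (Z · ω)) ∂P = 0) ∧
        Var[fun ω => L (I.restrict (Z · ω)); P] = ∑ i : I, ∑ j : I,
          L (Pi.single i 1) * L (Pi.single j 1) * ∫ ω, Z i ω * Z j ω ∂P := by
    intro Z hZ hZ0 L
    have hLp : ∀ t, MemLp (Z t) 2 P := fun t => (hZ.hasGaussianLaw_eval t).memLp_two
    have hexp : (fun ω => L (I.restrict (Z · ω))) =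
        fun ω => ∑ i : I, L (Pi.single i 1) * Z i ω := by
      ext ω
      conv_lhs => rw [← Finset.univ_sum_single (I.restrict (Z · ω))]
      rw [map_sum]
      refine Finset.sum_congr rfl fun i _ => ?_
      have : (Pi.single i (I.restrict (Z · ω) i) : I → ℝ) = Z i ω • Pi.single i 1 := by
        rw [← Pi.single_smul]; simp
      rw [this, map_smul, smul_eq_mul, mul_comm]
    have hint : ∀ i : I, MemLp (fun ω => L (Pi.single i 1) * Z i ω) 2 P :=
      fun i => (hLp i).const_mul _
    rw [hexp]
    constructor
    · rw [integral_finsetSum _ fun i _ => (hint i).integrable (by norm_num)]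
      exact Finset.sum_eq_zero fun i _ => by rw [integral_const_mul, hZ0, mul_zero]
    · rw [← covariance_self (by
          exact (Finset.aemeasurable_fun_sum _ fun i _ => (hint i).aestronglyMeasurable.aemeasurable)),
        covariance_fun_sum_fun_sum hint hint]
      refine Finset.sum_congr rfl fun i _ => Finset.sum_congr rfl fun j _ => ?_
      rw [covariance_const_mul_left, covariance_const_mul_right,
        covariance_eq_integral_mul (hLp _) (hLp _) (hZ0 _)]
      ring
  refine Measure.ext_of_charFunDual (funext fun L => ?_)
  rw [hXI.charFunDual_map_eq_fun L, hYI.charFunDual_map_eq_fun L, (key hX hX0 L).1,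
    (key hY hY0 L).1, (key hX hX0 L).2, (key hY hY0 L).2]
  simp_rw [h]

/-- The fourth moment of the standard Gaussian law. -/
def gaussianFourthMoment : ℝ := ∫ x, x ^ 4 ∂gaussianReal 0 1

theorem gaussianFourthMoment_nonneg : 0 ≤ gaussianFourthMoment :=
  integral_nonneg fun x => by positivity

theorem integral_pow_four_of_hasGaussianLaw {X : Ω → ℝ} (hX : HasGaussianLaw X P)
    (h0 : ∫ ω, X ω ∂P = 0) :
    ∫ ω, X ω ^ 4 ∂P = (∫ ω, X ω ^ 2 ∂P) ^ 2 * gaussianFourthMoment := by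
  have := hX.isProbabilityMeasure
  have hlaw := hX.map_eq_gaussianReal
  have hv : Var[X; P] = ∫ ω, X ω ^ 2 ∂P := variance_of_integral_eq_zero hX.aemeasurable h0
  have hnn : 0 ≤ Var[X; P] := variance_nonneg _ _
  rw [h0] at hlaw
  have hscale : (gaussianReal 0 1).map (√(Var[X; P]) * ·) = gaussianReal 0 (Var[X; P]).toNNReal := by
    rw [gaussianReal_map_const_mul]
    congr 1
    · simp
    · ext
      simp [hnn, Real.sq_sqrt]
  have h1 : ∫ ω, X ω ^ 4 ∂P = ∫ x, x ^ 4 ∂(P.map X) :=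
    (integral_map (f := fun x : ℝ => x ^ 4) hX.aemeasurable (by fun_prop)).symm
  rw [h1, hlaw, ← hscale, integral_map (by fun_prop) (by fun_prop)]
  simp_rw [mul_pow]
  rw [integral_const_mul, gaussianFourthMoment, ← hv]
  congr 1
  rw [show (4 : ℕ) = 2 * 2 from rfl, pow_mul, Real.sq_sqrt hnn]

end Gaussian

/-! ### Survival -/

section Survival

variable {d : ℕ}

/-- The configuration seen from the `i`-th child. -/
def shift (i : Fin d) (x : Address d → ℝ) : Address d → ℝ := fun a => x (i :: a.1, a.2)

/-- The configuration is positive along the first segment. -/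
def stubPos (d : ℕ) : Set (Address d → ℝ) := {x | ∀ q, 0 < x ([], q)}

/-- The configuration is positive along a chain of `n + 1` segments starting with the first. -/
def surviveN (d : ℕ) : ℕ → Set (Address d → ℝ)
  | 0 => stubPos d
  | n + 1 => stubPos d ∩ ⋃ i, shift i ⁻¹' surviveN d n

/-- The configuration is positive along arbitrarily long chains of segments starting with the
first. -/
def survive (d : ℕ) : Set (Address d → ℝ) := ⋂ n, surviveN d n

theorem measurable_shift (i : Fin d) : Measurable (shift i) :=
  measurable_pi_lambda _ fun _ => measurable_pi_apply _

theorem measurableSet_stubPos : MeasurableSet (stubPos d) := by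
  have : stubPos d = ⋂ q, (fun x : Address d → ℝ => x ([], q)) ⁻¹' Ioi 0 := by
    ext; simp [stubPos]
  rw [this]
  exact MeasurableSet.iInter fun q => measurable_pi_apply _ measurableSet_Ioi

theorem measurableSet_survive : MeasurableSet (survive d) := by
  refine MeasurableSet.iInter fun n => ?_
  induction n with
  | zero => exact measurableSet_stubPos
  | succ n ih =>
    exact measurableSet_stubPos.inter (MeasurableSet.iUnion fun i => measurable_shift i ih)

theorem surviveN_succ_subset (n : ℕ) : surviveN d (n + 1) ⊆ surviveN d n := by
  induction n with
  | zero => exact inter_subset_left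
  | succ n ih =>
    exact inter_subset_inter_right _ (iUnion_mono fun i => preimage_mono ih)

theorem antitone_surviveN : Antitone (surviveN d) := antitone_nat_of_succ_le surviveN_succ_subset

theorem survive_subset_stubPos : survive d ⊆ stubPos d := iInter_subset _ 0

/-- There are finitely many children and the events decrease with `n`: if each child failed at some
level, all would fail at the largest of these levels. -/
theorem exists_shift_mem_survive {x : Address d → ℝ} (hx : x ∈ survive d) :
    ∃ i, shift i x ∈ survive d := by
  by_contra! hcon
  have : ∀ i, ∃ n, shift i x ∉ surviveN d n := fun i => by
    have := hcon i
    simpa [survive] using this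
  choose n hn using this
  have h1 := mem_iInter.1 hx (Finset.univ.sup n + 1)
  obtain ⟨i, hi⟩ := mem_iUnion.1 h1.2
  exact hn i (antitone_surviveN (Finset.le_sup (Finset.mem_univ i)) hi)

end Survival

/-! ### Covariance structure of the field along the branches -/

/-- The properties of the Gaussian free field on the trees growing out of the darts of a regular tree
on which the extinction of the sign clusters rests; `D` is the set of darts. -/
structure BranchingField {Ω D : Type*} [MeasurableSpace Ω] (P : Measure Ω) (d : ℕ)
    (ch : D → Fin d → D) (X : D → Address d → Ω → ℝ) : Prop where
  gaussian : IsGaussianProcess (fun p : D × Address d => X p.1 p.2) P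
  measurable : ∀ e a, Measurable (X e a)
  centered : ∀ e a, ∫ ω, X e a ω ∂P = 0
  cons : ∀ e i w q, X e (i :: w, q) = X (ch e i) (w, q)
  glue : ∀ e i, X (ch e i) ([], 1) = X e ([], 0)
  cov_segment : ∀ e s t, s ≤ t →
    ∫ ω, X e ([], s) ω * X e ([], t) ω ∂P = segGreen d (s : ℚ) (t : ℚ)
  cov_child : ∀ e s i a, ∫ ω, X e ([], s) ω * X (ch e i) a ω ∂P =
    (diagGreen d - (s : ℚ) / (d + 1)) * rootGreen a / diagGreen d
  cov_siblings : ∀ e i j, i ≠ j → ∀ a b,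
    ∫ ω, X (ch e i) a ω * X (ch e j) b ω ∂P = rootGreen a * rootGreen b / diagGreen d

namespace BranchingField

variable {Ω D : Type*} [MeasurableSpace Ω] {P : Measure Ω} {d : ℕ} {ch : D → Fin d → D}
  {X : D → Address d → Ω → ℝ}

theorem isProbabilityMeasure (H : BranchingField P d ch X) (e : D) : IsProbabilityMeasure P := by
  have := (H.gaussian.hasGaussianLaw_eval (e, ([], 0))).isProbabilityMeasure
  exact this

theorem hasGaussianLaw (H : BranchingField P d ch X) (e : D) (a : Address d) :
    HasGaussianLaw (X e a) P := H.gaussian.hasGaussianLaw_eval (e, a)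

theorem shift_eq (H : BranchingField P d ch X) (e : D) (i : Fin d) (ω : Ω) :
    shift i (fun a => X e a ω) = fun a => X (ch e i) a ω := by
  ext ⟨w, q⟩
  simp only [shift, H.cons]

theorem measurable_path (H : BranchingField P d ch X) (e : D) :
    Measurable fun ω a => X e a ω := measurable_pi_lambda _ fun a => H.measurable e a

/-- Common letters of the two words are stripped until the words separate or one of them ends; from
there the covariance formulas do not mention the dart. -/
theorem integral_mul_eq (H : BranchingField P d ch X) (e e' : D) (a b : Address d) :
    ∫ ω, X e a ω * X e b ω ∂P = ∫ ω, X e' a ω * X e' b ω ∂P := by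
  obtain ⟨w, s⟩ := a
  obtain ⟨w', t⟩ := b
  induction w generalizing e e' w' with
  | nil =>
    cases w' with
    | nil =>
      rcases le_total s t with hst | hst
      · rw [H.cov_segment e s t hst, H.cov_segment e' s t hst]
      · simp_rw [mul_comm (X _ ([], s) _)]
        rw [H.cov_segment e t s hst, H.cov_segment e' t s hst]
    | cons j w' => rw [H.cons, H.cons, H.cov_child, H.cov_child]
  | cons i w ih =>
    rw [H.cons, H.cons]
    cases w' with
    | nil =>
      simp_rw [mul_comm (X _ (w, s) _)]
      rw [H.cov_child, H.cov_child]
    | cons j w' =>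
      rw [H.cons, H.cons]
      by_cases hij : i = j
      · subst hij
        exact ih _ _ _
      · rw [H.cov_siblings e i j hij, H.cov_siblings e' i j hij]

theorem map_eq (H : BranchingField P d ch X) (e e' : D) :
    P.map (fun ω a => X e a ω) = P.map (fun ω a => X e' a ω) :=
  map_eq_of_integral_mul_eq (H.gaussian.comp_right fun a => (e, a))
    (H.gaussian.comp_right fun a => (e', a)) (H.centered e) (H.centered e') (H.measurable e)
    (H.measurable e') (H.integral_mul_eq e e')

/-- The event that the tree growing out of `e` carries arbitrarily long positive chains. -/
def surviveSet (X : D → Address d → Ω → ℝ) (e : D) : Set Ω := {ω | (fun a => X e a ω) ∈ survive d}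

/-- The event that one of the trees growing out of the children of `e` carries arbitrarily long
positive chains. -/
def childSurviveSet (ch : D → Fin d → D) (X : D → Address d → Ω → ℝ) (e : D) : Set Ω :=
  ⋃ i, surviveSet X (ch e i)

theorem measurableSet_surviveSet (H : BranchingField P d ch X) (e : D) :
    MeasurableSet (surviveSet X e) := H.measurable_path e measurableSet_survive

theorem measurableSet_childSurviveSet (H : BranchingField P d ch X) (e : D) :
    MeasurableSet (childSurviveSet ch X e) :=
  MeasurableSet.iUnion fun _ => H.measurableSet_surviveSet _

theorem surviveSet_subset (H : BranchingField P d ch X) (e : D) :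
    surviveSet X e ⊆ childSurviveSet ch X e := by
  intro ω hω
  obtain ⟨i, hi⟩ := exists_shift_mem_survive hω
  rw [H.shift_eq] at hi
  exact mem_iUnion.2 ⟨i, hi⟩

theorem pos_of_mem_surviveSet {Ω D : Type*} {d : ℕ} {X : D → Address d → Ω → ℝ} {e : D} {ω : Ω}
    (hω : ω ∈ surviveSet X e) (q : Icc (0 : ℚ) 1) :
    0 < X e ([], q) ω := survive_subset_stubPos hω q

theorem pos_of_mem_childSurviveSet (H : BranchingField P d ch X) {e : D} {ω : Ω}
    (hω : ω ∈ childSurviveSet ch X e) : 0 < X e ([], 0) ω := by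
  obtain ⟨i, hi⟩ := mem_iUnion.1 hω
  rw [← H.glue e i]
  exact pos_of_mem_surviveSet hi 1

/-! ### The Markov property along a segment -/

theorem diagGreen_sub_pos (hd : 2 ≤ d) {t : ℝ} (ht : t ≤ 1) : 0 < diagGreen d - t / (d + 1) := by
  have h := diagGreen_eq hd
  have hd' : (2 : ℝ) ≤ d := by exact_mod_cast hd
  have h1 : 0 < (d : ℝ) + 1 := by linarith
  have h2 : (0 : ℝ) < (d : ℝ)⁻¹ := by positivity
  have h3 := mul_pos (mul_pos (diagGreen_pos hd) h2) h1
  rw [sub_pos, div_lt_iff₀ h1]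
  nlinarith

/-- The regression coefficient of the end of a segment on the point at fraction `t`. -/
def regr (d : ℕ) (t : ℝ) : ℝ := (diagGreen d - 1 / (d + 1)) / (diagGreen d - t / (d + 1))

theorem regr_nonneg (hd : 2 ≤ d) {t : ℝ} (ht : t ≤ 1) : 0 ≤ regr d t :=
  div_nonneg (diagGreen_sub_pos hd le_rfl).le (diagGreen_sub_pos hd ht).le

theorem regr_le_one (hd : 2 ≤ d) {t : ℝ} (ht : t ≤ 1) : regr d t ≤ 1 := by
  rw [regr, div_le_one (diagGreen_sub_pos hd ht)]
  have : t / ((d : ℝ) + 1) ≤ 1 / (d + 1) := by gcongr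
  linarith

/-- The factor lost along one segment exactly offsets the number `d` of children: the branching is
critical. -/
theorem regr_zero (hd : 2 ≤ d) : regr d 0 = (d : ℝ)⁻¹ := by
  have h := diagGreen_eq hd
  have hc := diagGreen_pos hd
  have hd' : (2 : ℝ) ≤ d := by exact_mod_cast hd
  have h1 : (d : ℝ) + 1 ≠ 0 := by linarith
  have h2 : (d : ℝ) ≠ 0 := by linarith
  rw [regr, zero_div, sub_zero, div_eq_iff hc.ne', sub_eq_iff_eq_add, eq_comm,
    ← eq_sub_iff_add_eq', div_eq_iff h1]
  linarith

/-- The part of the configuration at or beyond the point at fraction `s` of the segment of `e`. -/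
def beyond (ch : D → Fin d → D) (e : D) (s : Icc (0 : ℚ) 1) :
    (Fin d × Address d) ⊕ {q : Icc (0 : ℚ) 1 // q ≤ s} → D × Address d
  | Sum.inl p => (ch e p.1, p.2)
  | Sum.inr q => (e, ([], q.1))

/-- The residual of the starting value after regression on the value at `s` is centered and
independent of all that lies at or beyond `s`, so it integrates to zero over events determined
there. -/
theorem setIntegral_regr (hd : 2 ≤ d) (H : BranchingField P d ch X) (e : D) (s : Icc (0 : ℚ) 1)
    {T : Set ((Fin d × Address d) ⊕ {q : Icc (0 : ℚ) 1 // q ≤ s} → ℝ)} (hT : MeasurableSet T) :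
    ∫ ω in {ω | (fun b => X (beyond ch e s b).1 (beyond ch e s b).2 ω) ∈ T}, X e ([], 1) ω ∂P =
      regr d (s : ℚ) *
        ∫ ω in {ω | (fun b => X (beyond ch e s b).1 (beyond ch e s b).2 ω) ∈ T},
          X e ([], s) ω ∂P := by
  have := H.isProbabilityMeasure e
  have hs1 : ((s : ℚ) : ℝ) ≤ 1 := (unitRat_mem s).2
  have hpos := diagGreen_sub_pos hd hs1
  have hr : regr d (s : ℚ) * (diagGreen d - (s : ℚ) / (d + 1)) = diagGreen d - 1 / (d + 1) :=
    div_mul_cancel₀ _ hpos.ne'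
  have hind := indepFun_sub_of_integral_mul_eq H.gaussian (fun t => H.centered t.1 t.2)
    (fun _ : Unit => (e, ([], 1))) (fun _ => (e, ([], s))) (fun _ => regr d (s : ℚ))
    (beyond ch e s) (by
      rintro - (⟨i, a⟩ | ⟨q, hq⟩)
      · simp only [beyond]
        rw [H.cov_child, H.cov_child]
        push_cast
        linear_combination (-(rootGreen a / diagGreen d)) * hr
      · simp only [beyond]
        simp_rw [mul_comm _ (X e ([], q) _)]
        rw [H.cov_segment e q 1 q.2.2, H.cov_segment e q s hq, segGreen, segGreen]
        push_cast
        linear_combination (-(1 + ((d : ℝ) - 1) * ((q : ℚ) : ℝ))) * hr)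
  have hY : Measurable fun ω b => X (beyond ch e s b).1 (beyond ch e s b).2 ω :=
    measurable_pi_lambda _ fun b => H.measurable _ _
  have hU : Measurable fun ω (_ : Unit) => X e ([], 1) ω - regr d (s : ℚ) * X e ([], s) ω :=
    measurable_pi_lambda _ fun _ => (H.measurable _ _).sub ((H.measurable _ _).const_mul _)
  have i1 : Integrable (X e ([], 1)) P := (H.hasGaussianLaw _ _).integrable
  have i2 : Integrable (X e ([], s)) P := (H.hasGaussianLaw _ _).integrable
  have hmul := hind.integral_fun_comp_mul_comp (f := fun u : Unit → ℝ => u ())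
    (g := T.indicator fun _ => (1 : ℝ)) hU.aemeasurable hY.aemeasurable
    (measurable_pi_apply ()).aestronglyMeasurable
    (measurable_const.indicator hT).aestronglyMeasurable
  have hE : ∫ ω, (X e ([], 1) ω - regr d (s : ℚ) * X e ([], s) ω) ∂P = 0 := by
    rw [integral_sub i1 (i2.const_mul _), integral_const_mul, H.centered, H.centered]
    simp
  simp only [hE, zero_mul] at hmul
  set E : Set Ω := {ω | (fun b => X (beyond ch e s b).1 (beyond ch e s b).2 ω) ∈ T} with hEdef
  have hEm : MeasurableSet E := hY hT
  rw [← integral_const_mul, ← sub_eq_zero, ← integral_sub i1.integrableOn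
    (i2.const_mul _).integrableOn, ← integral_indicator hEm, ← hmul]
  refine integral_congr_ae (Filter.Eventually.of_forall fun ω => ?_)
  by_cases hω : ω ∈ E
  · have hω' : (fun b => X (beyond ch e s b).1 (beyond ch e s b).2 ω) ∈ T := hω
    simp only [indicator_of_mem hω, indicator_of_mem hω', mul_one]
  · have hω' : (fun b => X (beyond ch e s b).1 (beyond ch e s b).2 ω) ∉ T := hω
    simp only [indicator_of_notMem hω, indicator_of_notMem hω', mul_zero]

end BranchingField

namespace BranchingField

variable {Ω D : Type*} [MeasurableSpace Ω] {P : Measure Ω} {d : ℕ} {ch : D → Fin d → D}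
  {X : D → Address d → Ω → ℝ}

/-! ### The reflection inequality -/

/-- The left side is the sum of the two differences between a variance and the covariance, and each
of them is at most the distance of the fractions. -/
theorem integral_sq_increment_le (hd : 2 ≤ d) (H : BranchingField P d ch X) (e : D)
    {s t : Icc (0 : ℚ) 1} (hst : s ≤ t) :
    ∫ ω, (X e ([], t) ω - X e ([], s) ω) ^ 2 ∂P ≤ 2 * ((t : ℚ) - (s : ℚ) : ℝ) := by
  have hL : ∀ q, MemLp (X e ([], q)) 2 P := fun q => (H.hasGaussianLaw e _).memLp_two
  have hi : ∀ q r, Integrable (fun ω => X e ([], q) ω * X e ([], r) ω) P := fun q r =>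
    (hL q).integrable_mul (hL r)
  have hexp : (fun ω => (X e ([], t) ω - X e ([], s) ω) ^ 2) = fun ω =>
      (X e ([], t) ω * X e ([], t) ω - 2 * (X e ([], s) ω * X e ([], t) ω)) +
        X e ([], s) ω * X e ([], s) ω := by
    ext ω; ring
  have hsub : Integrable (fun ω => X e ([], t) ω * X e ([], t) ω -
      2 * (X e ([], s) ω * X e ([], t) ω)) P := (hi t t).sub ((hi s t).const_mul 2)
  rw [hexp, integral_add hsub (hi s s),
    integral_sub (hi t t) ((hi s t).const_mul 2), integral_const_mul,
    H.cov_segment e t t le_rfl, H.cov_segment e s t hst, H.cov_segment e s s le_rfl]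
  have hs := unitRat_mem s
  have ht := unitRat_mem t
  have hst' : ((s : ℚ) : ℝ) ≤ ((t : ℚ) : ℝ) := by exact_mod_cast hst
  generalize ((s : ℚ) : ℝ) = a at *
  generalize ((t : ℚ) : ℝ) = b at *
  have hd' : (2 : ℝ) ≤ d := by exact_mod_cast hd
  have h1 : (0 : ℝ) < d + 1 := by linarith
  have h2 : (d : ℝ) ≠ 0 := by linarith
  have hc : diagGreen d * (d - 1) = d / (d + 1) := by
    have h3 := diagGreen_eq hd
    field_simp at h3 ⊢
    linarith
  have hle : (d : ℝ) / (d + 1) ≤ 1 := by rw [div_le_one h1]; linarith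
  have e1 : segGreen d b b - segGreen d a b =
      (d / (d + 1) - b / (d + 1) * (d - 1)) * (b - a) := by
    rw [← hc, segGreen, segGreen]; ring
  have e2 : segGreen d a a - segGreen d a b = ((1 + (d - 1) * a) / (d + 1)) * (b - a) := by
    rw [segGreen, segGreen]; field_simp; ring
  have b1 : (d : ℝ) / (d + 1) - b / (d + 1) * (d - 1) ≤ 1 := by
    have : 0 ≤ b / ((d : ℝ) + 1) * (d - 1) :=
      mul_nonneg (div_nonneg ht.1 h1.le) (by linarith)
    linarith
  have b2 : (1 + ((d : ℝ) - 1) * a) / (d + 1) ≤ 1 := by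
    rw [div_le_one h1]
    nlinarith [hs.2]
  have m1 := mul_le_mul_of_nonneg_right b1 (sub_nonneg.2 hst')
  have m2 := mul_le_mul_of_nonneg_right b2 (sub_nonneg.2 hst')
  linarith

/-- Summed over `N` steps of length `1 / N`, fourth moments of increments tend to zero, which second
moments do not. -/
theorem integral_pow_four_increment_le (hd : 2 ≤ d) (H : BranchingField P d ch X) (e : D)
    {s t : Icc (0 : ℚ) 1} (hst : s ≤ t) {δ : ℝ} (hδ : ((t : ℚ) - (s : ℚ) : ℝ) ≤ δ) :
    ∫ ω, (X e ([], t) ω - X e ([], s) ω) ^ 4 ∂P ≤ (2 * δ) ^ 2 * gaussianFourthMoment := by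
  have hG : HasGaussianLaw (fun ω => X e ([], t) ω - X e ([], s) ω) P :=
    H.gaussian.hasGaussianLaw_fun_sub (s := (e, ([], t))) (t := (e, ([], s)))
  have h0 : ∫ ω, (X e ([], t) ω - X e ([], s) ω) ∂P = 0 := by
    rw [integral_sub (H.hasGaussianLaw _ _).integrable (H.hasGaussianLaw _ _).integrable,
      H.centered, H.centered, sub_zero]
  rw [integral_pow_four_of_hasGaussianLaw hG h0]
  have h1 := H.integral_sq_increment_le hd e hst
  have h2 : 0 ≤ ∫ ω, (X e ([], t) ω - X e ([], s) ω) ^ 2 ∂P :=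
    integral_nonneg fun ω => sq_nonneg _
  have h3 := gaussianFourthMoment_nonneg
  gcongr
  linarith

/-- The `k`-th point of a regular grid of mesh `1 / N` on a segment. -/
def grid (N k : ℕ) : Icc (0 : ℚ) 1 := ⟨min (k / N) 1, le_min (by positivity) zero_le_one, min_le_right _ _⟩

theorem grid_mono (N : ℕ) : Monotone (grid N) := by
  intro j k hjk
  refine Subtype.mk_le_mk.2 (min_le_min_right _ ?_)
  gcongr

theorem grid_zero (N : ℕ) : grid N 0 = 0 := by
  ext; simp [grid]

theorem grid_self {N : ℕ} (hN : 0 < N) : grid N N = 1 := by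
  have : (N : ℚ) ≠ 0 := by positivity
  ext; simp [grid, this]

theorem grid_succ_sub_le (N k : ℕ) :
    (((grid N (k + 1) : Icc (0 : ℚ) 1) : ℚ) - ((grid N k : Icc (0 : ℚ) 1) : ℚ) : ℝ) ≤ 1 / N := by
  have h : ((grid N (k + 1) : Icc (0 : ℚ) 1) : ℚ) - ((grid N k : Icc (0 : ℚ) 1) : ℚ) ≤ 1 / N := by
    simp only [grid]
    have h0 : (0 : ℚ) ≤ 1 / N := by positivity
    have h1 : ((k + 1 : ℕ) : ℚ) / N = k / N + 1 / N := by push_cast; ring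
    rw [h1]
    rcases le_total ((k : ℚ) / N) 1 with h | h
    · rw [min_eq_left h]
      have := min_le_left ((k : ℚ) / N + 1 / N) 1
      linarith
    · rw [min_eq_right h]
      have := min_le_right ((k : ℚ) / N + 1 / N) 1
      linarith
  have := (Rat.cast_le (K := ℝ)).2 h
  push_cast at this
  exact this

/-- The event that a chain survives beyond the segment of `e`, and that the field is positive at the
first `k + 1` points of the grid on this segment. -/
def gridPos (ch : D → Fin d → D) (X : D → Address d → Ω → ℝ) (e : D) (N k : ℕ) : Set Ω :=
  childSurviveSet ch X e ∩ ⋂ j : {j // j ≤ k}, X e ([], grid N j) ⁻¹' Ioi 0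

theorem measurableSet_gridPos (H : BranchingField P d ch X) (e : D) (N k : ℕ) :
    MeasurableSet (gridPos ch X e N k) :=
  (H.measurableSet_childSurviveSet e).inter
    (MeasurableSet.iInter fun _ => H.measurable _ _ measurableSet_Ioi)

theorem gridPos_zero (H : BranchingField P d ch X) (e : D) (N : ℕ) :
    gridPos ch X e N 0 = childSurviveSet ch X e := by
  refine inter_eq_left.2 fun ω hω => mem_iInter.2 ?_
  rintro ⟨j, hj⟩
  obtain rfl : j = 0 := by omega
  simp only [grid_zero]
  exact H.pos_of_mem_childSurviveSet hω

theorem gridPos_succ {Ω D : Type*} {d : ℕ} {ch : D → Fin d → D} {X : D → Address d → Ω → ℝ}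
    (e : D) (N k : ℕ) :
    gridPos ch X e N (k + 1) = gridPos ch X e N k \ (X e ([], grid N (k + 1)) ⁻¹' Iic 0) := by
  ext ω
  simp only [gridPos, mem_inter_iff, mem_iInter, mem_preimage, mem_Ioi, mem_sdiff, mem_Iic, not_le,
    Subtype.forall, and_assoc]
  refine and_congr_right fun _ => ⟨fun h => ⟨fun j hj => h j (by omega), h _ le_rfl⟩, ?_⟩
  rintro ⟨h1, h2⟩ j hj
  rcases Nat.le_succ_iff.1 hj with hj | rfl
  · exact h1 j hj
  · exact h2

/-- The grid runs from the far end `0` to the start `1`, so this event only involves the trees of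
the children and grid points up to the current one, and the regression identity applies. -/
theorem setIntegral_gridPos_diff (hd : 2 ≤ d) (H : BranchingField P d ch X) (e : D) (N k : ℕ) :
    ∫ ω in gridPos ch X e N k ∩ (X e ([], grid N (k + 1)) ⁻¹' Iic 0), X e ([], 1) ω ∂P =
      regr d (grid N (k + 1) : ℚ) *
        ∫ ω in gridPos ch X e N k ∩ (X e ([], grid N (k + 1)) ⁻¹' Iic 0),
          X e ([], grid N (k + 1)) ω ∂P := by
  set s := grid N (k + 1) with hs
  let T : Set ((Fin d × Address d) ⊕ {q : Icc (0 : ℚ) 1 // q ≤ s} → ℝ) :=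
    ((⋃ i, (fun x a => x (Sum.inl (i, a))) ⁻¹' survive d) ∩
      ⋂ j : {j // j ≤ k}, (fun x => x (Sum.inr ⟨grid N j, grid_mono N (j.2.trans k.le_succ)⟩)) ⁻¹'
        Ioi 0) ∩ (fun x => x (Sum.inr ⟨s, le_rfl⟩)) ⁻¹' Iic 0
  have hT : MeasurableSet T := by
    refine (MeasurableSet.inter (MeasurableSet.iUnion fun i => ?_)
      (MeasurableSet.iInter fun j => ?_)).inter ?_
    · exact (measurable_pi_lambda _ fun a => measurable_pi_apply _) measurableSet_survive
    · exact measurable_pi_apply _ measurableSet_Ioi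
    · exact measurable_pi_apply _ measurableSet_Iic
  have hset : gridPos ch X e N k ∩ (X e ([], s) ⁻¹' Iic 0) =
      {ω | (fun b => X (beyond ch e s b).1 (beyond ch e s b).2 ω) ∈ T} := by
    ext ω
    simp [gridPos, T, beyond, childSurviveSet, surviveSet]
  rw [hset]
  exact H.setIntegral_regr hd e s hT

theorem abs_le_add_pow_four_div {η : ℝ} (hη : 0 < η) (x : ℝ) : |x| ≤ η + x ^ 4 / η ^ 3 := by
  have h4 : x ^ 4 = |x| ^ 4 := by rw [← abs_pow, abs_of_nonneg (by positivity)]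
  have h0 := abs_nonneg x
  rw [h4]
  rcases le_total |x| η with h | h
  · have : 0 ≤ |x| ^ 4 / η ^ 3 := by positivity
    linarith
  · have : |x| ≤ |x| ^ 4 / η ^ 3 := by
      rw [le_div_iff₀ (by positivity)]
      calc |x| * η ^ 3 ≤ |x| * |x| ^ 3 := by gcongr
        _ = |x| ^ 4 := by ring
    linarith

/-- The step removes the paths that have just become nonpositive. Their contribution is a factor in
`[0, 1]` times the integral of an overshoot below zero. The term with `η * P.real` charges the part
of the overshoot of size `η` to the probability removed, so that these costs telescope over the
grid. -/
theorem setIntegral_gridPos_succ_le (hd : 2 ≤ d) (H : BranchingField P d ch X) (e : D) (N k : ℕ)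
    {η : ℝ} (hη : 0 < η) :
    ∫ ω in gridPos ch X e N (k + 1), X e ([], 1) ω ∂P + η * P.real (gridPos ch X e N (k + 1)) ≤
      ∫ ω in gridPos ch X e N k, X e ([], 1) ω ∂P + η * P.real (gridPos ch X e N k) +
        (2 * (1 / N)) ^ 2 * gaussianFourthMoment / η ^ 3 := by
  have := H.isProbabilityMeasure e
  set A := gridPos ch X e N k with hA
  set s := grid N k
  set t := grid N (k + 1) with ht
  set B := X e ([], t) ⁻¹' Iic 0 with hB
  have hst : s ≤ t := grid_mono N k.le_succ
  have mA : MeasurableSet A := H.measurableSet_gridPos e N k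
  have mB : MeasurableSet B := H.measurable _ _ measurableSet_Iic
  have hint : ∀ a, Integrable (X e a) P := fun a => (H.hasGaussianLaw e a).integrable
  have i1 := integral_inter_add_sdiff (μ := P) (s := A) mB (hint ([], 1)).integrableOn
  have i2 := measureReal_inter_add_sdiff (μ := P) (s := A) mB
  have i3 := H.setIntegral_gridPos_diff hd e N k
  rw [gridPos_succ, ← hA, ← ht, ← hB]
  rw [← hA, ← ht, ← hB] at i3
  have hincr : HasGaussianLaw (fun ω => X e ([], t) ω - X e ([], s) ω) P :=
    H.gaussian.hasGaussianLaw_fun_sub (s := (e, ([], t))) (t := (e, ([], s)))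
  have hincr4 : Integrable (fun ω => (X e ([], t) ω - X e ([], s) ω) ^ 4) P := by
    have := (hincr.memLp (p := 4) (by norm_num)).integrable_norm_pow (p := 4) (by norm_num)
    refine this.congr (Filter.Eventually.of_forall fun ω => ?_)
    simp only [Real.norm_eq_abs]
    rw [← abs_pow, abs_of_nonneg (by positivity)]
  have hr0 := regr_nonneg hd (unitRat_mem t).2
  have hr1 := regr_le_one hd (unitRat_mem t).2
  have hbound : -∫ ω in A ∩ B, X e ([], t) ω ∂P ≤ η * P.real (A ∩ B) +
      (2 * (1 / N)) ^ 2 * gaussianFourthMoment / η ^ 3 := by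
    calc -∫ ω in A ∩ B, X e ([], t) ω ∂P = ∫ ω in A ∩ B, -X e ([], t) ω ∂P := by
          rw [integral_neg]
      _ ≤ ∫ ω in A ∩ B, (η + (X e ([], t) ω - X e ([], s) ω) ^ 4 / η ^ 3) ∂P := by
          refine setIntegral_mono_on (hint _).neg.integrableOn
            ((integrable_const _).add (hincr4.div_const _)).integrableOn (mA.inter mB) ?_
          rintro ω ⟨hωA, hωB⟩
          -- The field is positive at `s` and nonpositive at `t`, so the overshoot is at most the
          -- increment.
          refine le_trans ?_ (abs_le_add_pow_four_div hη _)
          have hpos : 0 < X e ([], s) ω := mem_iInter.1 hωA.2 ⟨k, le_rfl⟩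
          have hneg : X e ([], t) ω ≤ 0 := hωB
          rw [abs_of_nonpos (by linarith)]
          linarith
      _ = η * P.real (A ∩ B) +
          (∫ ω in A ∩ B, (X e ([], t) ω - X e ([], s) ω) ^ 4 ∂P) / η ^ 3 := by
          rw [integral_add (integrable_const _).integrableOn (hincr4.div_const _).integrableOn,
            setIntegral_const, integral_div, smul_eq_mul, mul_comm]
      _ ≤ _ := by
          gcongr
          refine (setIntegral_le_integral hincr4 (Filter.Eventually.of_forall fun ω => ?_)).trans
            (H.integral_pow_four_increment_le hd e hst (grid_succ_sub_le N k))
          positivity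
  have hneg : 0 ≤ -∫ ω in A ∩ B, X e ([], t) ω ∂P := by
    rw [neg_nonneg]
    exact setIntegral_nonpos (mA.inter mB) fun ω hω => hω.2
  have hmul := mul_le_mul_of_nonneg_right hr1 hneg
  nlinarith

/-- The reflection inequality: integrating the value at the far end of a segment over the event that
the field is positive along the whole segment does not give more than integrating it without this
constraint. -/
theorem setIntegral_surviveSet_le (hd : 2 ≤ d) (H : BranchingField P d ch X) (e : D) :
    ∫ ω in surviveSet X e, X e ([], 1) ω ∂P ≤
      (d : ℝ)⁻¹ * ∫ ω in childSurviveSet ch X e, X e ([], 0) ω ∂P := by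
  have := H.isProbabilityMeasure e
  have hint : ∀ a, Integrable (X e a) P := fun a => (H.hasGaussianLaw e a).integrable
  have hstart : ∫ ω in childSurviveSet ch X e, X e ([], 1) ω ∂P =
      (d : ℝ)⁻¹ * ∫ ω in childSurviveSet ch X e, X e ([], 0) ω ∂P := by
    let T : Set ((Fin d × Address d) ⊕ {q : Icc (0 : ℚ) 1 // q ≤ 0} → ℝ) :=
      ⋃ i, (fun x a => x (Sum.inl (i, a))) ⁻¹' survive d
    have hT : MeasurableSet T := MeasurableSet.iUnion fun i =>
      (measurable_pi_lambda _ fun a => measurable_pi_apply _) measurableSet_survive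
    have hset : childSurviveSet ch X e =
        {ω | (fun b => X (beyond ch e 0 b).1 (beyond ch e 0 b).2 ω) ∈ T} := by
      ext ω
      simp [T, beyond, childSurviveSet, surviveSet]
    have := H.setIntegral_regr hd e 0 hT
    rw [← hset] at this
    rw [this, ← regr_zero hd]
    simp
  rw [← hstart]
  have key : ∀ N : ℕ, 0 < N → ∀ η : ℝ, 0 < η →
      ∫ ω in surviveSet X e, X e ([], 1) ω ∂P ≤ ∫ ω in childSurviveSet ch X e, X e ([], 1) ω ∂P +
        η + N * ((2 * (1 / N)) ^ 2 * gaussianFourthMoment / η ^ 3) := by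
    intro N hN η hη
    have hind : ∀ k : ℕ, ∫ ω in gridPos ch X e N k, X e ([], 1) ω ∂P +
        η * P.real (gridPos ch X e N k) ≤ ∫ ω in childSurviveSet ch X e, X e ([], 1) ω ∂P +
          η * P.real (childSurviveSet ch X e) +
          k * ((2 * (1 / N)) ^ 2 * gaussianFourthMoment / η ^ 3) := by
      intro k
      induction k with
      | zero => rw [H.gridPos_zero]; simp
      | succ k ih =>
        have := H.setIntegral_gridPos_succ_le hd e N k hη
        push_cast
        linarith
    have hsub : surviveSet X e ⊆ gridPos ch X e N N := fun ω hω =>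
      ⟨H.surviveSet_subset e hω, mem_iInter.2 fun j => pos_of_mem_surviveSet hω _⟩
    have hmono : ∫ ω in surviveSet X e, X e ([], 1) ω ∂P ≤
        ∫ ω in gridPos ch X e N N, X e ([], 1) ω ∂P := by
      refine setIntegral_mono_set (hint _).integrableOn ?_ hsub.eventuallyLE
      refine (ae_restrict_iff' (H.measurableSet_gridPos e N N)).2
        (Filter.Eventually.of_forall fun ω hω => ?_)
      have := mem_iInter.1 hω.2 ⟨N, le_rfl⟩
      simp only [grid_self hN] at this
      exact le_of_lt this
    have h1 := hind N
    have h2 : η * P.real (childSurviveSet ch X e) ≤ η :=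
      mul_le_of_le_one_right hη.le measureReal_le_one
    have h3 : 0 ≤ η * P.real (gridPos ch X e N N) := mul_nonneg hη.le measureReal_nonneg
    linarith
  -- With `η` fixed, `N → ∞` removes the accumulated error, of order `1 / (N * η ^ 3)`; then `η` is
  -- arbitrary.
  refine le_of_forall_pos_le_add fun η hη => ?_
  have hlim : Filter.Tendsto (fun N : ℕ => ∫ ω in childSurviveSet ch X e, X e ([], 1) ω ∂P +
      η + 4 * gaussianFourthMoment / η ^ 3 * (1 / (N : ℝ))) Filter.atTop
      (nhds (∫ ω in childSurviveSet ch X e, X e ([], 1) ω ∂P + η +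
        4 * gaussianFourthMoment / η ^ 3 * 0)) :=
    (tendsto_one_div_atTop_nhds_zero_nat.const_mul _).const_add _
  rw [mul_zero, add_zero] at hlim
  refine ge_of_tendsto hlim ?_
  filter_upwards [Filter.eventually_gt_atTop 0] with N hN
  refine (key N hN η hη).trans (le_of_eq ?_)
  have : (N : ℝ) ≠ 0 := by positivity
  field_simp
  ring

end BranchingField

theorem measure_preimage_prod_of_indepFun {Ω α β : Type*} [MeasurableSpace Ω] [MeasurableSpace α]
    [MeasurableSpace β] {P : Measure Ω} [IsProbabilityMeasure P] {U : Ω → α} {W : Ω → β}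
    (h : IndepFun U W P) (hU : Measurable U) (hW : Measurable W) {A : Set (α × β)}
    (hA : MeasurableSet A) :
    P {ω | (U ω, W ω) ∈ A} = ∫⁻ ω, P.map W (Prod.mk (U ω) ⁻¹' A) ∂P := by
  have := Measure.isProbabilityMeasure_map (μ := P) hW.aemeasurable
  have h1 : {ω | (U ω, W ω) ∈ A} = (fun ω => (U ω, W ω)) ⁻¹' A := rfl
  rw [h1, ← Measure.map_apply (hU.prodMk hW) hA,
    (indepFun_iff_map_prod_eq_prod_map_map hU.aemeasurable hW.aemeasurable).1 h,
    Measure.prod_apply hA, lintegral_map (measurable_measure_prodMk_left hA) hU]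

namespace BranchingField

variable {Ω D : Type*} [MeasurableSpace Ω] {P : Measure Ω} {d : ℕ} {ch : D → Fin d → D}
  {X : D → Address d → Ω → ℝ}

/-! ### Extinction -/

theorem measure_surviveSet_eq (H : BranchingField P d ch X) (e e' : D) :
    P (surviveSet X e) = P (surviveSet X e') := by
  have h : ∀ e, P (surviveSet X e) = P.map (fun ω a => X e a ω) (survive d) := fun e =>
    (Measure.map_apply (H.measurable_path e) measurableSet_survive).symm
  rw [h e, h e', H.map_eq e e']

theorem setIntegral_surviveSet_eq (H : BranchingField P d ch X) (e e' : D) :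
    ∫ ω in surviveSet X e, X e ([], 1) ω ∂P = ∫ ω in surviveSet X e', X e' ([], 1) ω ∂P := by
  have h : ∀ e, ∫ ω in surviveSet X e, X e ([], 1) ω ∂P =
      ∫ x in survive d, x ([], 1) ∂(P.map fun ω a => X e a ω) := fun e =>
    (setIntegral_map measurableSet_survive (measurable_pi_apply _).aestronglyMeasurable
      (H.measurable_path e).aemeasurable).symm
  rw [h e, h e', H.map_eq e e']

/-- Two different children of a dart cannot both carry arbitrarily long positive chains. -/
theorem measure_surviveSet_inter (hd : 2 ≤ d) (H : BranchingField P d ch X) (e : D) {i j : Fin d}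
    (hij : i ≠ j) : P (surviveSet X (ch e i) ∩ surviveSet X (ch e j)) = 0 := by
  have hprob := H.isProbabilityMeasure e
  have hd0 : (0 : ℝ) < d := by exact_mod_cast (by omega : 0 < d)
  set F := X e ([], 0) with hF
  set R := fun k => surviveSet X (ch e k) with hR
  have hFint : Integrable F P := (H.hasGaussianLaw _ _).integrable
  have mR : ∀ k, MeasurableSet (R k) := fun k => H.measurableSet_surviveSet _
  have mS := H.measurableSet_childSurviveSet e
  have hpos : ∀ {k ω}, ω ∈ R k → 0 < F ω := fun {k ω} hω =>
    H.pos_of_mem_childSurviveSet (mem_iUnion.2 ⟨k, hω⟩)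
  have hRk : ∀ k, ∫ ω in R k, F ω ∂P = ∫ ω in surviveSet X e, X e ([], 1) ω ∂P := by
    intro k
    rw [← H.setIntegral_surviveSet_eq (ch e k) e, H.glue]
  -- Where `F` is positive, the indicators of the union of the `R k` and of `R i ∩ R j` add up to at
  -- most the sum of the indicators of all `R k`.
  have hsum : ∫ ω in childSurviveSet ch X e, F ω ∂P + ∫ ω in R i ∩ R j, F ω ∂P ≤
      d * ∫ ω in surviveSet X e, X e ([], 1) ω ∂P := by
    have h1 : (d : ℝ) * ∫ ω in surviveSet X e, X e ([], 1) ω ∂P =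
        ∫ ω, ∑ k, (R k).indicator F ω ∂P := by
      rw [integral_finsetSum _ fun k _ => hFint.indicator (mR k)]
      simp_rw [integral_indicator (mR _), hRk]
      simp
    rw [h1, ← integral_indicator mS, ← integral_indicator ((mR i).inter (mR j)),
      ← integral_add (hFint.indicator mS) (hFint.indicator ((mR i).inter (mR j)))]
    refine integral_mono ((hFint.indicator mS).add (hFint.indicator ((mR i).inter (mR j))))
      (integrable_finsetSum _ fun k _ => hFint.indicator (mR k)) fun ω => ?_
    have hnn : ∀ k ∈ (Finset.univ : Finset (Fin d)), 0 ≤ (R k).indicator F ω := fun k _ =>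
      indicator_apply_nonneg fun hω => (hpos hω).le
    by_cases hω : ω ∈ R i ∩ R j
    · have hS : ω ∈ childSurviveSet ch X e := mem_iUnion.2 ⟨i, hω.1⟩
      have h2 := Finset.sum_le_sum_of_subset_of_nonneg (Finset.subset_univ {i, j})
        (fun k hk _ => hnn k hk)
      rw [Finset.sum_pair hij] at h2
      simpa only [Pi.add_apply, indicator_of_mem hS, indicator_of_mem hω, indicator_of_mem hω.1,
        indicator_of_mem hω.2] using h2
    · by_cases hS : ω ∈ childSurviveSet ch X e
      · obtain ⟨k, hk⟩ := mem_iUnion.1 hS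
        have h2 := Finset.single_le_sum hnn (Finset.mem_univ k)
        have hk' : ω ∈ R k := hk
        simpa only [indicator_of_mem hS, indicator_of_notMem hω, indicator_of_mem hk', add_zero]
          using h2
      · simpa only [indicator_of_notMem hS, indicator_of_notMem hω, add_zero] using
          Finset.sum_nonneg hnn
  -- Since `d * d⁻¹ = 1`, the reflection inequality leaves no room for the integral over the
  -- intersection.
  have hrefl := H.setIntegral_surviveSet_le hd e
  rw [inv_mul_eq_div, le_div_iff₀ hd0] at hrefl
  have hle : ∫ ω in R i ∩ R j, F ω ∂P ≤ 0 := by linarith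
  have hae : 0 ≤ᵐ[P.restrict (R i ∩ R j)] F := (ae_restrict_iff' ((mR i).inter (mR j))).2
    (Filter.Eventually.of_forall fun ω hω => (hpos hω.1).le)
  have h0 := (setIntegral_eq_zero_iff_of_nonneg_ae hae hFint.integrableOn).1
    (le_antisymm hle (integral_nonneg_of_ae hae))
  rw [Filter.EventuallyEq, ae_restrict_iff' ((mR i).inter (mR j))] at h0
  refine measure_mono_null (fun ω hω => ?_) h0
  intro hcon
  exact (hpos hω.1).ne' (hcon hω)

theorem rootGreen_nil_one : rootGreen (([], 1) : Address d) = diagGreen d := by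
  simp [rootGreen]

theorem cov_root (hd : 2 ≤ d) (H : BranchingField P d ch X) (e : D) (a : Address d) :
    ∫ ω, X e a ω * X e ([], 1) ω ∂P = rootGreen a := by
  have hd' : (2 : ℝ) ≤ d := by exact_mod_cast hd
  have h1 : (d : ℝ) ^ 2 - 1 ≠ 0 := by nlinarith
  have h2 : (d : ℝ) ≠ 0 := by linarith
  have h3 : (d : ℝ) + 1 ≠ 0 := by linarith
  obtain ⟨w, s⟩ := a
  cases w with
  | nil =>
    rw [H.cov_segment e s 1 s.2.2, segGreen, rootGreen, diagGreen]
    simp only [List.length_nil]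
    push_cast
    field_simp
    ring
  | cons i w =>
    rw [H.cons]
    simp_rw [mul_comm (X (ch e i) (w, s) _)]
    rw [H.cov_child, rootGreen, rootGreen, diagGreen]
    simp only [List.length_cons, pow_succ]
    push_cast
    field_simp
    ring

/-- Let `κ r` be the probability of survival given the value `r` at the starting vertex. By
conditional independence of the siblings `f` and `g`, integrating `κ` over the survival of `f` gives
the probability that both survive, which is zero; so `κ` vanishes almost surely on the survival of
`f`. But up to a null set `f` survives only where `κ` is nonzero. -/
theorem measure_surviveSet_child (hd : 2 ≤ d) (H : BranchingField P d ch X) (e : D) (i : Fin d) :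
    P (surviveSet X (ch e i)) = 0 := by
  have hprob := H.isProbabilityMeasure e
  have hc := (diagGreen_pos hd).ne'
  obtain ⟨j, hji⟩ : ∃ j, j ≠ i := by
    have : Nontrivial (Fin d) := Fin.nontrivial_iff_two_le.2 hd
    exact exists_ne i
  set f := ch e i with hf
  set g := ch e j with hg
  set ρ : Address d → ℝ := fun a => rootGreen a / diagGreen d with hρ
  have hroot : X g ([], 1) = X f ([], 1) := (H.glue e j).trans (H.glue e i).symm
  -- `Y` is the residual after regression on the starting vertex: `Y f` is independent of the value
  -- there, and `Y g` of the whole tree of `f`.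
  set Y : D → Ω → Address d → ℝ := fun e ω a => X e a ω - ρ a * X e ([], 1) ω with hY
  have mY : ∀ e, Measurable (Y e) := fun e => measurable_pi_lambda _ fun a =>
    (H.measurable _ _).sub ((H.measurable _ _).const_mul _)
  have hind1 : IndepFun (X f ([], 1)) (Y f) P := by
    have := indepFun_sub_of_integral_mul_eq H.gaussian (fun t => H.centered t.1 t.2)
      (fun a : Address d => (f, a)) (fun _ => (f, ([], 1))) ρ (fun _ : Unit => (f, ([], 1)))
      (fun a _ => by
        dsimp only
        rw [H.cov_root hd, H.cov_root hd, rootGreen_nil_one, div_mul_cancel₀ _ hc])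
    exact (this.comp measurable_id (measurable_pi_apply ())).symm
  have hind2 : IndepFun (fun ω a => X f a ω) (Y g) P := by
    have := indepFun_sub_of_integral_mul_eq H.gaussian (fun t => H.centered t.1 t.2)
      (fun a : Address d => (g, a)) (fun _ => (g, ([], 1))) ρ (fun b : Address d => (f, b))
      (fun a b => by
        dsimp only
        rw [H.cov_siblings e j i hji, H.cov_siblings e j i hji, rootGreen_nil_one, hρ]
        field_simp)
    exact this.symm
  have hlaw : P.map (Y g) = P.map (Y f) := by
    let Θ : (Address d → ℝ) → Address d → ℝ := fun x a => x a - ρ a * x ([], 1)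
    have mΘ : Measurable Θ := measurable_pi_lambda _ fun a =>
      (measurable_pi_apply _).sub ((measurable_pi_apply _).const_mul _)
    have h1 : ∀ e, P.map (Y e) = (P.map fun ω a => X e a ω).map Θ := fun e => by
      rw [Measure.map_map mΘ (H.measurable_path e)]; rfl
    rw [h1, h1, H.map_eq g f]
  set κ : ℝ → ENNReal := fun r => P.map (Y f) {y | (fun a => ρ a * r + y a) ∈ survive d} with hκ
  have mjoin : Measurable fun p : ℝ × (Address d → ℝ) => fun a => ρ a * p.1 + p.2 a :=
    measurable_pi_lambda _ fun a =>
      (measurable_fst.const_mul _).add ((measurable_pi_apply a).comp measurable_snd)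
  have mset : MeasurableSet {p : ℝ × (Address d → ℝ) | (fun a => ρ a * p.1 + p.2 a) ∈ survive d} :=
    mjoin measurableSet_survive
  have hprobY := Measure.isProbabilityMeasure_map (μ := P) (mY f).aemeasurable
  have mκ : Measurable κ := measurable_measure_prodMk_left mset
  have mB : MeasurableSet {r | κ r ≠ 0} := mκ (measurableSet_singleton 0).compl
  have mjoin' : Measurable fun p : (Address d → ℝ) × (Address d → ℝ) =>
      fun a => ρ a * p.1 ([], 1) + p.2 a :=
    measurable_pi_lambda _ fun a =>
      (((measurable_pi_apply ([], 1)).comp measurable_fst).const_mul _).add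
        ((measurable_pi_apply a).comp measurable_snd)
  have hjoin : ∀ ω, (fun a => ρ a * X f ([], 1) ω + Y f ω a) = fun a => X f a ω := fun ω => by
    ext a; simp [hY]
  have hjoin' : ∀ ω, (fun a => ρ a * X f ([], 1) ω + Y g ω a) = fun a => X g a ω := fun ω => by
    ext a; simp [hY, hroot]
  have e1 : P (surviveSet X f) = ∫⁻ ω, κ (X f ([], 1) ω) ∂P := by
    have := measure_preimage_prod_of_indepFun hind1 (H.measurable _ _) (mY f) mset
    simp only [mem_ofPred_eq, hjoin] at this
    exact this
  have e2 : P (surviveSet X f ∩ {ω | κ (X f ([], 1) ω) ≠ 0}) = ∫⁻ ω, κ (X f ([], 1) ω) ∂P := by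
    have := measure_preimage_prod_of_indepFun hind1 (H.measurable _ _) (mY f)
      (mset.inter (mB.preimage measurable_fst))
    simp only [mem_inter_iff, mem_ofPred_eq, hjoin, mem_preimage] at this
    refine this.trans (lintegral_congr fun ω => ?_)
    by_cases h0 : κ (X f ([], 1) ω) = 0
    · rw [h0]
      refine measure_mono_null (fun y hy => ?_) h0
      exact hy.1
    · refine congrArg _ (Set.ext fun y => ?_)
      exact ⟨fun hy => hy.1, fun hy => ⟨hy, h0⟩⟩
  have e3 : ∫⁻ ω, (surviveSet X f).indicator (fun ω => κ (X f ([], 1) ω)) ω ∂P = 0 := by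
    have := measure_preimage_prod_of_indepFun hind2 (H.measurable_path f) (mY g)
      (A := {p | p.1 ∈ survive d ∧ (fun a => ρ a * p.1 ([], 1) + p.2 a) ∈ survive d})
      ((measurableSet_survive.preimage measurable_fst).inter 
        (measurableSet_survive.preimage mjoin'))
    simp only [mem_ofPred_eq, hjoin'] at this
    rw [← H.measure_surviveSet_inter hd e hji.symm]
    refine (this.trans (lintegral_congr fun ω => ?_)).symm
    rw [hlaw]
    by_cases hω : ω ∈ surviveSet X f
    · rw [indicator_of_mem hω]
      refine congrArg _ (Set.ext fun y => ?_)
      exact ⟨fun hy => hy.2, fun hy => ⟨hω, hy⟩⟩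
    · rw [indicator_of_notMem hω]
      refine measure_mono_null (fun y hy => ?_) measure_empty
      exact hω hy.1
  have mκX : Measurable fun ω => κ (X f ([], 1) ω) := mκ.comp (H.measurable _ _)
  rw [lintegral_eq_zero_iff (mκX.indicator (H.measurableSet_surviveSet f))] at e3
  rw [e1, ← e2]
  refine measure_mono_null (fun ω hω => ?_) e3
  intro hcon
  have hcon' : (surviveSet X f).indicator (fun ω => κ (X f ([], 1) ω)) ω = 0 := hcon
  rw [indicator_of_mem hω.1] at hcon'
  exact hω.2 hcon'

theorem measure_surviveSet (hd : 2 ≤ d) (H : BranchingField P d ch X) (e : D) :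
    P (surviveSet X e) = 0 := by
  rw [H.measure_surviveSet_eq e (ch e ⟨0, by omega⟩)]
  exact H.measure_surviveSet_child hd e _

end BranchingField

/-! ### Connected sets in the cable system of a tree -/

theorem lin_eq_sum (f : V → ℝ) {u v : V} (huv : G.Adj u v) (s : ℝ) {F : Finset V} (hu : u ∈ F)
    (hv : v ∈ F) : lin f (edgePt huv s) = ∑ w ∈ F, (edgePt huv s).1 w * f w := by
  refine finsum_eq_sum_of_support_subset _ fun w hw => ?_
  by_contra hn
  have hwu : w ≠ u := fun h => hn (by rw [h]; exact hu)
  have hwv : w ≠ v := fun h => hn (by rw [h]; exact hv)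
  exact hw (by simp [edgePt_apply_of_ne huv s hwu hwv])

/-- The weights sum to `1`, so those off `x` and `y` contribute at most `M` times what is left. Near
a point of the edge `xy` this remainder is small, which gives continuity for coordinatewise
convergence. -/
theorem lin_bounds {f : V → ℝ} {M : ℝ} (h0 : ∀ v, 0 ≤ f v) (hM : ∀ v, f v ≤ M) {x y : V}
    (hxy : x ≠ y) (q : CableSystem G) :
    q.1 x * f x + q.1 y * f y ≤ lin f q ∧
      lin f q ≤ q.1 x * f x + q.1 y * f y + M * (1 - q.1 x - q.1 y) := by
  classical
  obtain ⟨u, v, huv, s, hs, hq⟩ := exists_eq_edgePt q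
  set F : Finset V := {x, y, u, v} with hF
  have hsplit : ∀ g : V → ℝ, lin g q = q.1 x * g x + q.1 y * g y +
      ∑ w ∈ (F.erase x).erase y, q.1 w * g w := by
    intro g
    have h1 : lin g q = ∑ w ∈ F, q.1 w * g w := by
      rw [hq]; exact lin_eq_sum g huv s (by simp [hF]) (by simp [hF])
    rw [h1, ← Finset.add_sum_erase F _ (a := x) (by simp [hF]),
      ← Finset.add_sum_erase (F.erase x) _ (a := y) (by simp [hF, hxy.symm]), add_assoc]
  have hone : ∑ w ∈ (F.erase x).erase y, q.1 w = 1 - q.1 x - q.1 y := by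
    have h1 := hsplit fun _ => 1
    have h2 : lin (fun _ => (1 : ℝ)) q = 1 := by rw [hq, lin_edgePt _ huv hs]; ring
    simp only [mul_one] at h1
    linarith
  have hnn : 0 ≤ ∑ w ∈ (F.erase x).erase y, q.1 w * f w :=
    Finset.sum_nonneg fun w _ => mul_nonneg (q.2.1 w) (h0 w)
  have hle : ∑ w ∈ (F.erase x).erase y, q.1 w * f w ≤ M * (1 - q.1 x - q.1 y) := by
    rw [← hone, Finset.mul_sum]
    refine Finset.sum_le_sum fun w _ => ?_
    rw [mul_comm]
    exact mul_le_mul_of_nonneg_right (hM w) (q.2.1 w)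
  rw [hsplit f]
  constructor <;> linarith

theorem continuous_lin {f : V → ℝ} {M : ℝ} (h0 : ∀ v, 0 ≤ f v) (hM : ∀ v, f v ≤ M) :
    Continuous (lin f : CableSystem G → ℝ) := by
  rw [continuous_iff_continuousAt]
  intro p
  obtain ⟨x, y, hxy, t, ht, hp⟩ := exists_eq_edgePt p
  have hev : ∀ v, Continuous fun q : CableSystem G => q.1 v := fun v =>
    (continuous_apply v).comp continuous_subtype_val
  have hpx : p.1 x = 1 - t := by rw [hp, edgePt_apply_fst hxy ht]
  have hpy : p.1 y = t := by rw [hp, edgePt_apply_snd hxy ht]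
  have hlin : lin f p = p.1 x * f x + p.1 y * f y := by rw [hpx, hpy, hp, lin_edgePt f hxy ht]
  have c1 : Continuous fun q : CableSystem G => q.1 x * f x + q.1 y * f y :=
    ((hev x).mul continuous_const).add ((hev y).mul continuous_const)
  have c2 : Continuous fun q : CableSystem G => q.1 x * f x + q.1 y * f y +
      M * (1 - q.1 x - q.1 y) :=
    c1.add (continuous_const.mul ((continuous_const.sub (hev x)).sub (hev y)))
  have t1 := c1.tendsto p
  have t2 := c2.tendsto p
  have hz : M * (1 - p.1 x - p.1 y) = 0 := by rw [hpx, hpy]; ring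
  rw [hz, add_zero, ← hlin] at t2
  rw [← hlin] at t1
  exact tendsto_of_tendsto_of_tendsto_of_le_of_le t1 t2 (fun q => (lin_bounds h0 hM hxy.ne q).1)
    fun q => (lin_bounds h0 hM hxy.ne q).2

/-- The vertex `v` lies on the far side of the dart `e`. -/
def Beyond (e : G.Dart) (v : V) : Prop := G.dist e.fst v = G.dist e.snd v + 1

theorem not_beyond_iff (hT : G.IsTree) (e : G.Dart) (v : V) :
    ¬ Beyond e v ↔ G.dist e.snd v = G.dist e.fst v + 1 := by
  have := hT.dist_eq_dist_add_one_of_adj v e.adj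
  rw [G.dist_comm, G.dist_comm (u := v)] at this
  rw [Beyond]
  omega

theorem not_beyond_fst (e : G.Dart) : ¬ Beyond e e.fst := by
  simp [Beyond]

theorem beyond_snd (e : G.Dart) : Beyond e e.snd := by
  simp [Beyond, SimpleGraph.dist_eq_one_iff_adj.2 e.adj]

/-- The only edge between the two sides of a dart in a tree is the edge of this dart. -/
theorem eq_of_adj_of_beyond (hT : G.IsTree) (e : G.Dart) {u v : V} (huv : G.Adj u v)
    (hu : ¬ Beyond e u) (hv : Beyond e v) : u = e.fst ∧ v = e.snd := by
  rw [not_beyond_iff hT] at hu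
  have hv' : G.dist e.fst v = G.dist e.snd v + 1 := hv
  have h1 := hT.dist_eq_dist_add_one_of_adj e.fst huv
  have h2 := hT.dist_eq_dist_add_one_of_adj e.snd huv
  have hvs : v = e.snd := by
    -- Otherwise a neighbour `p` of `v` is closer to both ends of `e`, and stepping from `p` through
    -- `v` to `u` moves away from `e.fst`. The distance to `e.snd` would then change by three along
    -- the edge `uv`.
    by_contra hne
    obtain ⟨p, hadj, hp⟩ := exists_adj_dist_add_one hT.connected (Ne.symm hne)
    have h5 := hT.dist_eq_dist_add_one_of_adj e.fst hadj
    have h6 := hT.dist_eq_dist_add_one_of_adj p e.adj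
    rw [G.dist_comm, G.dist_comm (v := e.snd)] at h6
    have hne' : p ≠ u := by
      rintro rfl
      omega
    have := dist_eq_add_one_of_ne hT (u := e.fst) hadj huv.symm hne' (by omega)
    omega
  subst hvs
  simp only [SimpleGraph.dist_self] at hv' h2
  refine ⟨?_, rfl⟩
  have : G.dist e.fst u = 0 := by omega
  exact ((hT.connected.dist_eq_zero_iff).1 this).symm

open Classical in
/-- A height function on the vertices of a tree: it is `1` and `2` at the two ends of a dart, `0` at
the other vertices on the near side, and `3` at the other vertices on the far side. -/
def height (e : G.Dart) (v : V) : ℝ :=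
  if Beyond e v then (if v = e.snd then 2 else 3) else (if v = e.fst then 1 else 0)

theorem height_nonneg (e : G.Dart) (v : V) : 0 ≤ height e v := by
  unfold height; split_ifs <;> norm_num

theorem height_le (e : G.Dart) (v : V) : height e v ≤ 3 := by
  unfold height; split_ifs <;> norm_num

theorem height_le_one {e : G.Dart} {v : V} (h : ¬ Beyond e v) : height e v ≤ 1 := by
  rw [height, if_neg h]; split_ifs <;> norm_num

theorem two_le_height {e : G.Dart} {v : V} (h : Beyond e v) : 2 ≤ height e v := by
  rw [height, if_pos h]; split_ifs <;> norm_num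

theorem height_of_ne_fst {e : G.Dart} {v : V} (h : ¬ Beyond e v) (hv : v ≠ e.fst) :
    height e v = 0 := by
  rw [height, if_neg h, if_neg hv]

theorem height_of_ne_snd {e : G.Dart} {v : V} (h : Beyond e v) (hv : v ≠ e.snd) :
    height e v = 3 := by
  rw [height, if_pos h, if_neg hv]

theorem height_fst (e : G.Dart) : height e e.fst = 1 := by
  rw [height, if_neg (not_beyond_fst e), if_pos rfl]

theorem height_snd (e : G.Dart) : height e e.snd = 2 := by
  rw [height, if_pos (beyond_snd e), if_pos rfl]

/-- Heights `0` and `3` at the other vertices ensure that even the extreme values `1` and `2` are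
taken only at the ends of `e`. -/
theorem eq_edgePt_of_lin_height (hT : G.IsTree) (e : G.Dart) {t : ℝ} (ht : t ∈ Icc (0 : ℝ) 1)
    (q : CableSystem G) (hq : lin (height e) q = 1 + t) : q = edgePt e.adj t := by
  obtain ⟨u, v, huv, s, hs, rfl⟩ := exists_eq_edgePt q
  have hs1 : 0 ≤ 1 - s := by linarith [hs.2]
  have near : ∀ {u v : V} (huv : G.Adj u v) {s : ℝ}, s ∈ Icc (0 : ℝ) 1 → ¬ Beyond e u →
      ¬ Beyond e v → v ≠ e.fst → (1 - s) * height e u + s * height e v = 1 + t →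
      edgePt huv s = edgePt e.adj t := by
    intro u v huv s hs hu hv hne h
    rw [height_of_ne_fst hv hne] at h
    by_cases huf : u = e.fst
    · subst huf
      rw [height_fst] at h
      have hs0 : s = 0 := by linarith [hs.1, ht.1]
      have ht0 : t = 0 := by linarith [hs.1, ht.1]
      rw [hs0, ht0, edgePt_zero_eq huv e.adj]
    · rw [height_of_ne_fst hu huf] at h
      linarith [ht.1]
  have far : ∀ {u v : V} (huv : G.Adj u v) {s : ℝ}, s ∈ Icc (0 : ℝ) 1 → Beyond e u →
      Beyond e v → v ≠ e.snd → (1 - s) * height e u + s * height e v = 1 + t →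
      edgePt huv s = edgePt e.adj t := by
    intro u v huv s hs hu hv hne h
    rw [height_of_ne_snd hv hne] at h
    by_cases huf : u = e.snd
    · subst huf
      rw [height_snd] at h
      have hs0 : s = 0 := by linarith [hs.1, ht.2]
      have ht1 : t = 1 := by linarith [hs.1, ht.2]
      rw [hs0, ht1, edgePt_zero_eq huv e.adj.symm, ← edgePt_symm e.adj 1, sub_self]
    · rw [height_of_ne_snd hu huf] at h
      linarith [ht.2]
  have cross : ∀ {u v : V} (huv : G.Adj u v) {s : ℝ}, ¬ Beyond e u → Beyond e v →
      (1 - s) * height e u + s * height e v = 1 + t → edgePt huv s = edgePt e.adj t := by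
    intro u v huv s hu hv h
    obtain ⟨rfl, rfl⟩ := eq_of_adj_of_beyond hT e huv hu hv
    rw [height_fst, height_snd] at h
    have : s = t := by linarith
    rw [this]
  rw [lin_edgePt _ huv hs] at hq
  have hq' : (1 - (1 - s)) * height e v + (1 - s) * height e u = 1 + t := by linarith
  have hs' : 1 - s ∈ Icc (0 : ℝ) 1 := ⟨hs1, by linarith [hs.1]⟩
  by_cases hu : Beyond e u <;> by_cases hv : Beyond e v
  · by_cases hvs : v = e.snd
    · have hus : u ≠ e.snd := fun h => huv.ne (h.trans hvs.symm)
      rw [← edgePt_symm huv]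
      exact far huv.symm hs' hv hu hus hq'
    · exact far huv hs hu hv hvs hq
  · rw [← edgePt_symm huv]
    exact cross huv.symm hv hu hq'
  · exact cross huv hu hv hq
  · by_cases hvs : v = e.fst
    · have hus : u ≠ e.fst := fun h => huv.ne (h.trans hvs.symm)
      rw [← edgePt_symm huv]
      exact near huv.symm hs' hv hu hus hq'
    · exact near huv hs hu hv hvs hq

/-- The height is at most `1` at the first point and at least `2` at the second; the intermediate
value theorem yields every point of the segment. -/
theorem edgePt_mem_of_isPreconnected (hT : G.IsTree) (e : G.Dart) {C : Set (CableSystem G)}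
    (hC : IsPreconnected C) {x y u v : V} (hxy : G.Adj x y) (huv : G.Adj u v) {r s : ℝ}
    (hr : r ∈ Icc (0 : ℝ) 1) (hs : s ∈ Icc (0 : ℝ) 1) (hz : edgePt hxy r ∈ C)
    (hp : edgePt huv s ∈ C) (hx : ¬ Beyond e x) (hy : ¬ Beyond e y) (hu : Beyond e u)
    (hv : Beyond e v) {t : ℝ} (ht : t ∈ Icc (0 : ℝ) 1) : edgePt e.adj t ∈ C := by
  have hcont : Continuous (lin (height e) : CableSystem G → ℝ) :=
    continuous_lin (height_nonneg e) (height_le e)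
  have h1 : lin (height e) (edgePt hxy r) ≤ 1 := by
    rw [lin_edgePt _ hxy hr]
    have m1 := mul_le_mul_of_nonneg_left (height_le_one hx) (sub_nonneg.2 hr.2)
    have m2 := mul_le_mul_of_nonneg_left (height_le_one hy) hr.1
    linarith
  have h2 : 2 ≤ lin (height e) (edgePt huv s) := by
    rw [lin_edgePt _ huv hs]
    have m1 := mul_le_mul_of_nonneg_left (two_le_height hu) (sub_nonneg.2 hs.2)
    have m2 := mul_le_mul_of_nonneg_left (two_le_height hv) hs.1
    linarith
  obtain ⟨q, hqC, hq⟩ := hC.intermediate_value hz hp hcont.continuousOn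
    (show 1 + t ∈ Icc _ _ from ⟨by linarith [ht.1], by linarith [ht.2]⟩)
  rwa [← eq_edgePt_of_lin_height hT e ht q hq]

/-! ### From unbounded clusters to surviving darts -/

namespace ChildEnum

variable {d : ℕ} (ch : ChildEnum G d)

theorem beyond_of_beyond_child (hT : G.IsTree) {e : G.Dart} {i : Fin d} {v : V}
    (h : Beyond (ch.child e i) v) : Beyond e v := by
  have hadj := (ch.child e i).adj
  rw [Beyond, ch.fst_child] at h
  rw [ch.fst_child] at hadj
  rw [Beyond, G.dist_comm, G.dist_comm (v := v)]
  refine dist_eq_add_one_of_ne hT hadj.symm e.adj.symm (ch.snd_ne e i) ?_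
  rw [G.dist_comm, h, G.dist_comm]

theorem exists_beyond_child (hT : G.IsTree) {e : G.Dart} {v : V} (h : Beyond e v)
    (hne : v ≠ e.snd) : ∃ i, Beyond (ch.child e i) v := by
  obtain ⟨p, hadj, hp⟩ := exists_adj_dist_add_one hT.connected hne
  have h' : G.dist e.fst v = G.dist e.snd v + 1 := h
  rw [G.dist_comm, G.dist_comm (v := v)] at h'
  obtain ⟨i, hi⟩ := ch.surj e p hadj.symm (by
    rintro rfl
    omega)
  refine ⟨i, ?_⟩
  rw [Beyond, ch.fst_child, hi, G.dist_comm, G.dist_comm (v := v)]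
  omega

theorem beyond_child_of_adj (hT : G.IsTree) {e : G.Dart} {i : Fin d} {u v : V} (huv : G.Adj u v)
    (hu : Beyond (ch.child e i) u) (hv : v ≠ e.snd) : Beyond (ch.child e i) v := by
  by_contra hcon
  have := (eq_of_adj_of_beyond hT _ huv.symm hcon hu).1
  rw [ch.fst_child] at this
  exact hv this

/-- A connected set on which `ψ` is positive, and which goes from the near side of a dart to a point
far away on the far side, yields a chain of segments on which `ψ` is positive. -/
theorem mem_surviveN_of_isPreconnected (hT : G.IsTree) {C : Set (CableSystem G)}
    (hC : IsPreconnected C) {ψ : CableSystem G → ℝ} (hψ : ∀ p ∈ C, 0 < ψ p) {x y u v : V}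
    (hxy : G.Adj x y) (huv : G.Adj u v) {r s : ℝ} (hr : r ∈ Icc (0 : ℝ) 1)
    (hs : s ∈ Icc (0 : ℝ) 1) (hz : edgePt hxy r ∈ C) (hp : edgePt huv s ∈ C) (n : ℕ) :
    ∀ e : G.Dart, ¬ Beyond e x → ¬ Beyond e y → Beyond e u → Beyond e v →
      n + 2 ≤ G.dist e.fst u → n + 2 ≤ G.dist e.fst v →
      (fun a => ψ (ch.point e a)) ∈ surviveN d n := by
  have stub : ∀ e : G.Dart, ¬ Beyond e x → ¬ Beyond e y → Beyond e u → Beyond e v →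
      (fun a => ψ (ch.point e a)) ∈ stubPos d := by
    intro e hx hy hu hv q
    have hq := unitRat_mem q
    refine hψ _ ?_
    simp only [point, desc]
    rw [← edgePt_symm]
    exact edgePt_mem_of_isPreconnected hT e hC hxy huv hr hs hz hp hx hy hu hv
      ⟨by linarith [hq.2], by linarith [hq.1]⟩
  induction n with
  | zero => exact fun e hx hy hu hv _ _ => stub e hx hy hu hv
  | succ n ih =>
    intro e hx hy hu hv hdu hdv
    refine ⟨stub e hx hy hu hv, ?_⟩
    have hu' : G.dist e.fst u = G.dist e.snd u + 1 := hu
    have hv' : G.dist e.fst v = G.dist e.snd v + 1 := hv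
    have hus : u ≠ e.snd := by
      rintro rfl
      rw [SimpleGraph.dist_self] at hu'
      omega
    have hvs : v ≠ e.snd := by
      rintro rfl
      rw [SimpleGraph.dist_self] at hv'
      omega
    obtain ⟨i, hi⟩ := ch.exists_beyond_child hT hu hus
    refine mem_iUnion.2 ⟨i, ih (ch.child e i) (fun h => hx (ch.beyond_of_beyond_child hT h))
      (fun h => hy (ch.beyond_of_beyond_child hT h)) hi (ch.beyond_child_of_adj hT huv hi hvs) ?_ ?_⟩
    · rw [ch.fst_child]; omega
    · rw [ch.fst_child]; omega

/-- An unbounded connected set on which `ψ` is positive yields a dart out of which grow arbitrarily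
long chains of segments on which `ψ` is positive. -/
theorem exists_mem_survive (hT : G.IsTree) {C : Set (CableSystem G)} (hC : IsPreconnected C)
    {ψ : CableSystem G → ℝ} (hψ : ∀ p ∈ C, 0 < ψ p) {z : CableSystem G} (hz : z ∈ C)
    (hunb : ¬ IsBoundedSubset G C) : ∃ e : G.Dart, (fun a => ψ (ch.point e a)) ∈ survive d := by
  obtain ⟨x, y, hxy, r, hr, rfl⟩ := exists_eq_edgePt z
  set e₀ : G.Dart := ⟨(x, y), hxy⟩ with he₀
  -- A cluster reaching far from the edge `xy` leaves it through a child of one of its two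
  -- orientations. This list is finite and does not depend on `n`.
  let dart : Fin d ⊕ Fin d → G.Dart := Sum.elim (ch.child e₀) (ch.child e₀.symm)
  have hnear : ∀ k, ¬ Beyond (dart k) x ∧ ¬ Beyond (dart k) y := by
    have h1 : ∀ (e : G.Dart) i, ¬ Beyond (ch.child e i) e.fst ∧ ¬ Beyond (ch.child e i) e.snd := by
      intro e i
      refine ⟨fun h => not_beyond_fst e (ch.beyond_of_beyond_child hT h), fun h => ?_⟩
      have := not_beyond_fst (ch.child e i)
      rw [ch.fst_child] at this
      exact this h
    rintro (i | i)
    · exact h1 e₀ i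
    · exact (h1 e₀.symm i).symm
  have hstep : ∀ n : ℕ, ∃ k, (fun a => ψ (ch.point (dart k) a)) ∈ surviveN d n := by
    intro n
    simp only [IsBoundedSubset, not_exists, not_forall, not_le] at hunb
    -- An endpoint of nonzero weight is at distance at least `n + 4` from `x`; one unit may be lost
    -- at the other endpoint, and one more in measuring from `y`.
    obtain ⟨p, hp, hfar⟩ := hunb x (n + 4)
    obtain ⟨u, v, huv, s, hs, rfl⟩ := exists_eq_edgePt p
    have hbdd : BddBelow (range fun w : {w : V // (edgePt huv s).1 w ≠ 0} =>
        (G.dist x w : ℝ) + (1 - (edgePt huv s).1 w)) := by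
      refine ⟨-1, ?_⟩
      rintro - ⟨w, rfl⟩
      have : (edgePt huv s).1 w ≤ 1 := by
        by_cases hwu : (w : V) = u
        · rw [hwu, edgePt_apply_fst huv hs]; linarith [hs.1]
        · by_cases hwv : (w : V) = v
          · rw [hwv, edgePt_apply_snd huv hs]; exact hs.2
          · rw [edgePt_apply_of_ne huv s hwu hwv]; exact zero_le_one
      have : (0 : ℝ) ≤ G.dist x w := by positivity
      linarith
    have hone : ∀ w, (edgePt huv s).1 w ≠ 0 → n + 4 ≤ G.dist x w := by
      intro w hw
      have h1 := lt_of_lt_of_le hfar (ciInf_le hbdd ⟨w, hw⟩)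
      have h2 := (edgePt huv s).2.1 w
      have h3 : ((n + 4 : ℕ) : ℝ) < ((G.dist x w + 1 : ℕ) : ℝ) := by
        push_cast at h1 ⊢
        linarith
      have h4 : n + 4 < G.dist x w + 1 := by exact_mod_cast h3
      omega
    have hdist := hT.dist_eq_dist_add_one_of_adj x huv
    have hxuv : n + 3 ≤ G.dist x u ∧ n + 3 ≤ G.dist x v := by
      by_cases hs0 : s = 0
      · have := hone u (by rw [edgePt_apply_fst huv hs, hs0]; norm_num)
        omega
      · have := hone v (by rw [edgePt_apply_snd huv hs]; exact hs0)
        omega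
    have hyu := hT.dist_eq_dist_add_one_of_adj u hxy
    have hyv := hT.dist_eq_dist_add_one_of_adj v hxy
    simp only [G.dist_comm (u := u)] at hyu
    simp only [G.dist_comm (u := v)] at hyv
    have hmain : ∀ (e : G.Dart), ((e.fst = x ∧ e.snd = y) ∨ (e.fst = y ∧ e.snd = x)) →
        (∀ i, ¬ Beyond (ch.child e i) x ∧ ¬ Beyond (ch.child e i) y) → Beyond e u →
        ∃ i, (fun a => ψ (ch.point (ch.child e i) a)) ∈ surviveN d n := by
      intro e he hn hu
      have hdu : n + 2 ≤ G.dist e.snd u := by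
        rcases he with ⟨-, h⟩ | ⟨-, h⟩ <;> rw [h] <;> omega
      have hdv : n + 2 ≤ G.dist e.snd v := by
        rcases he with ⟨-, h⟩ | ⟨-, h⟩ <;> rw [h] <;> omega
      have hus : u ≠ e.snd := by
        rintro rfl
        rw [SimpleGraph.dist_self] at hdu
        omega
      have hvs : v ≠ e.snd := by
        rintro rfl
        rw [SimpleGraph.dist_self] at hdv
        omega
      obtain ⟨i, hi⟩ := ch.exists_beyond_child hT hu hus
      refine ⟨i, ch.mem_surviveN_of_isPreconnected hT hC hψ hxy huv hr hs hz hp n _ (hn i).1 (hn i).2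
        hi (ch.beyond_child_of_adj hT huv hi hvs) ?_ ?_⟩
      · rw [ch.fst_child]; exact hdu
      · rw [ch.fst_child]; exact hdv
    by_cases hu : Beyond e₀ u
    · obtain ⟨i, hi⟩ := hmain e₀ (Or.inl ⟨rfl, rfl⟩) (fun i => hnear (Sum.inl i)) hu
      exact ⟨Sum.inl i, hi⟩
    · rw [not_beyond_iff hT] at hu
      obtain ⟨i, hi⟩ := hmain e₀.symm (Or.inr ⟨rfl, rfl⟩) (fun i => hnear (Sum.inr i)) hu
      exact ⟨Sum.inr i, hi⟩
  -- Finitely many darts and decreasing events: a single dart serves all `n`.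
  by_contra! hcon
  have : ∀ k, ∃ n, (fun a => ψ (ch.point (dart k) a)) ∉ surviveN d n := fun k => by
    have := hcon (dart k)
    simpa [survive] using this
  choose n hn using this
  obtain ⟨k, hk⟩ := hstep (Finset.univ.sup n)
  exact hn k (antitone_surviveN (Finset.le_sup (Finset.mem_univ k)) hk)

end ChildEnum

/-! ### The free field as a branching field -/

/-- Measurable versions are chosen point by point of the cable system. Thus `cons` and `glue`, being
equalities of points, hold exactly, and covariances are unchanged. -/
theorem IsGFF.exists_branchingField [G.LocallyFinite] {d : ℕ} (hd : 2 ≤ d) (hT : G.IsTree)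
    (hreg : G.IsRegularOfDegree (d + 1)) {Ω : Type*} [MeasurableSpace Ω] {P : Measure Ω}
    {φ : CableSystem G → Ω → ℝ} (hφ : IsGFF G P φ) (ch : ChildEnum G d) :
    ∃ ξ : CableSystem G → Ω → ℝ, (∀ z, φ z =ᵐ[P] ξ z) ∧
      BranchingField P d ch.child fun e a => ξ (ch.point e a) := by
  set ξ : CableSystem G → Ω → ℝ := fun z => (hφ.gaussian.aemeasurable z).mk with hξ
  have hae : ∀ z, φ z =ᵐ[P] ξ z := fun z => (hφ.gaussian.aemeasurable z).ae_eq_mk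
  have hcov : ∀ z w, ∫ ω, ξ z ω * ξ w ω ∂P = green G z w := by
    intro z w
    rw [← hφ.covariance z w]
    refine integral_congr_ae ?_
    filter_upwards [hae z, hae w] with ω h1 h2
    rw [h1, h2]
  refine ⟨ξ, hae, ⟨?_, fun e a => ?_, fun e a => ?_, fun e i w q => ?_, fun e i => ?_,
    fun e s t hst => ?_, fun e s i a => ?_, fun e i j hij a b => ?_⟩⟩
  · exact (hφ.gaussian.congr hae).comp_right fun p : G.Dart × Address d => ch.point p.1 p.2
  · exact (hφ.gaussian.aemeasurable _).measurable_mk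
  · rw [← integral_congr_ae (hae _), hφ.centered]
  · simp only [ch.point_cons]
  · simp only [ch.point_child_one]
  · rw [hcov, ch.green_segment hd hT hreg e hst]
  · rw [hcov, ch.green_stub_child hd hT hreg]
  · rw [hcov, ch.green_siblings hd hT hreg e hij]

end CableGFF

end

/-! ### Almost sure boundedness of the positive clusters -/

theorem proposition4p1 {V : Type*} (G : SimpleGraph V) [G.LocallyFinite] (d : ℕ) (hd : 2 ≤ d)
    (hT : G.IsTree) (hreg : G.IsRegularOfDegree (d + 1))
    {Ω : Type*} [MeasurableSpace Ω] (P : Measure Ω) [IsProbabilityMeasure P]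
    (φ : CableGFF.CableSystem G → Ω → ℝ) (hφ : CableGFF.IsGFF G P φ) :
    ∀ᵐ ω ∂P, ∀ z : CableGFF.CableSystem G, 0 < φ z ω →
      CableGFF.IsBoundedSubset G (connectedComponentIn {w | 0 < φ w ω} z) := by
  obtain ⟨ch⟩ := CableGFF.exists_childEnum hreg
  obtain ⟨ξ, hae, H⟩ := hφ.exists_branchingField hd hT hreg ch
  have hV := CableGFF.countable_of_locallyFinite hT.connected
  have hD : Countable G.Dart := SimpleGraph.Dart.toProd_injective.countable
  have h1 : ∀ᵐ ω ∂P, ∀ e : G.Dart, ∀ a, φ (ch.point e a) ω = ξ (ch.point e a) ω :=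
    ae_all_iff.2 fun e => ae_all_iff.2 fun a => hae _
  have h2 : ∀ᵐ ω ∂P, ∀ e : G.Dart, (fun a => ξ (ch.point e a) ω) ∉ CableGFF.survive d :=
    ae_all_iff.2 fun e => measure_eq_zero_iff_ae_notMem.1 (H.measure_surviveSet hd e)
  filter_upwards [h1, h2] with ω hω1 hω2 z hz
  by_contra hcon
  obtain ⟨e, he⟩ := ch.exists_mem_survive hT isPreconnected_connectedComponentIn
    (ψ := fun w => φ w ω) (fun p hp => connectedComponentIn_subset {w | 0 < φ w ω} z hp)
    (mem_connectedComponentIn (x := z) hz) hcon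
  refine hω2 e ?_
  simp only [hω1] at he
  exact he
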